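/- **Setting.** Let $N,M\ge 1$ and $1\le L\le N$. Given are channels $H=[h_1,\dots,h_M]\in\mathbb C^{N\times M}$, noise levels $\sigma_m>0$ and SINR targets $\gamma_m>0$ (and, for imperfect CSI, error radii $\varepsilon_m>0$). For $W=[w_1,\dots,w_M]\in\mathbb C^{N\times M}$ and $h\in\mathbb C^N$ let $$\mathrm{SINR}_m(W,h)=\frac{|w_m^Hh|^2}{\sum_{\ell\ne m}|w_\ell^Hh|^2+\sigma_m^2},\qquad \mathcal U_m=\{h_m+e:\|e\|_2\le\varepsilon_m\}.$$ The joint BF&AS problem is to minimize $\|W\|_F^2$ subject to $\mathrm{SINR}_m(W,h_m)\ge\gamma_m$ for all $m$ and at most $L$ nonzero rows of $W$; in the joint RBF&AS problem the SINR constraint is $\min_{h\in\mathcal U_m}\mathrm{SINR}_m(W,h)\ge\gamma_m$ for all $m$. **Subproblems.** For $B\subseteq[N]$ let $\mathcal P(B)$ be the following convex program. For BF it is the SOCP: minimize $\|W\|_F^2$ subject to $\gamma_m^{-1/2}\,\mathrm{Re}(w_m^Hh_m)\ge\big(\sum_{\ell\ne m}|w_\ell^Hh_m|^2+\sigma_m^2\big)^{1/2}$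 for all $m$ and $W(n,:)=0$ for $n\in B$. For RBF it is the semidefinite relaxation (SDR): minimize $\sum_m\mathrm{Tr}(W_m)$ over positive semidefinite $W_1,\dots,W_M\in\mathbb C^{N\times N}$ subject to $\frac{h^HW_mh}{\sum_{j\ne m}h^HW_jh+\sigma_m^2}\ge\gamma_m$ for all $m$ and $h\in\mathcal U_m$, and $W_m(n,:)=0$ for $n\in B$; a beamforming matrix is read off its solution if $W_m=w_mw_m^H$ for all $m$. A solver returns an arbitrary optimal solution of $\mathcal P(B)$, or reports infeasibility (value $+\infty$). The power of antenna $n$ in a solution is $\|W(n,:)\|_2^2$, respectively $\sum_mW_m(n,n)$. **The B&B procedure.** A node is a pair $(A,B)$ of disjoint sets of activated and shut-down antennas; as soon as $|A|=L$ one sets $B=[N]\setminus A$, and as soon as $|B|=N-L$ one sets $A=[N]\setminus B$; the node is then a leaf. The lower bound $\Phi_{\rm lb}(A,B)$ is the value of $\mathcal P(B)$. The upper bound $\Phi_{\rm ub}(A,B)$ is $\|W\|_F^2$ for the beamforming matrix $W$ obtained from $\mathcal P(\tilde B)$, where $\tilde B\supseteq B$ has $N-L$ elements and consists of $B$ and of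 undecided antennas of smallest power in the solution of $\mathcal P(B)$ ($+\infty$ if there is no such $W$). The procedure starts with the root $(\emptyset,\emptyset)$ as the only unbranched node, its lower bound as $l_G$, its upper bound as $u_G$ and its upper bound solution as incumbent. While the set $\mathcal F$ of unbranched nodes is nonempty and $|u_G-l_G|/l_G>\epsilon$ ($\epsilon\ge0$ a given tolerance; the gap is $0$ if $u_G=l_G=+\infty$), it removes from $\mathcal F$ a non-leaf node of lowest lower bound, selects an undecided antenna $n$ of largest power in its lower bound solution, adds the children that shut down, respectively activate, $n$; replaces $u_G$ and the incumbent by the better upper bound of the two children if that is $\le u_G$; sets $l_G$ to the minimum of $\Phi_{\rm lb}$ on $\mathcal F$; and discards from $\mathcal F$ the nodes with $\Phi_{\rm lb}>u_G$. It returns the incumbent. Ties are broken arbitrarily. Solutions of programs are stored: a program that was solved before is not solved again. **The alternative B&B** is the same procedure for the formulation with Boolean variables $z\in\{0,1\}^N$, $\sum_nz(n)\le L$, $\|W(n,:)\|_2\le Cz(n)$, where $C>0$ is a constant. The lower bound at $(A,B)$ is the value of the SOCP/SDR in $(W,z)$ with $z\in[0,1]^N$, $\sum_nz(n)\le L$,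 $z=0$ on $B$, $z=1$ on $A$ and $\|W(n,:)\|_2\le Cz(n)$ (in the SDR: $\sum_mW_m(n,n)\le C^2z(n)$); the upper bound is the same program at the leaf $([N]\setminus\tilde B,\tilde B)$; the branching antenna and the undecided antennas in $\tilde B$ are chosen in any way. **Theorem.** (a) *(Perfect CSI.)* For every SOCP solver and every $\epsilon\ge0$, the proposed B&B procedure terminates and solves the joint BF&AS problem to global optimality: it returns a feasible $W$ with $\|W\|_F^2\le(1+\epsilon)\|W'\|_F^2$ for every feasible $W'$ (in particular an exact global minimizer if $\epsilon=0$), or it returns nothing, and then the problem is infeasible. (b) *(Imperfect CSI.)* Suppose that for every $\mathcal S\subseteq[N]$ with $|\mathcal S|\ge L$ the matrix $\tilde H=H(\mathcal S,:)$ with columns $\tilde h_m$ satisfies, for all $m$, $$\frac{\|\Pi_m\tilde h_m\|_2^2}{\varepsilon_m^2}>1+M+\Big(M-\frac1M\Big)\gamma_m,\qquad \Pi_m=I-\tilde H_{-m}(\tilde H_{-m}^H\tilde H_{-m})^{-1}\tilde H_{-m}^H,$$ where $\tilde H_{-m}$ is $\tilde H$ without its $m$-th column and $\tilde H_{-m}^H\tilde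 H_{-m}$ is invertible. Then, for every SDR solver, the conclusion of (a) holds for the proposed B&B procedure and the joint RBF&AS problem. (c) In both cases (for imperfect CSI also without the condition in (b)), every run of the proposed B&B procedure is finite and the total number of SOCPs/SDRs solved in it is at most $$\binom NL+\sum_{i=2}^{N-L+1}\binom{N-i}{L-1}.$$ Every run of the alternative B&B is finite and the number of SOCPs/SDRs solved in it is at most $2\binom NL-1$. All the programs above have an optimal solution whenever they are feasible, so solvers exist. -/

import Mathlib

open scoped NNReal ENNReal ComplexOrder Matrix

noncomputable section

namespace BFAS

/-! ### The beamforming and antenna selection problems -/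

/-- Beamforming matrices: one row per antenna, one column per user. -/
abbrev Beam (N M : ℕ) : Type := Matrix (Fin N) (Fin M) ℂ

/-- A problem instance: channel matrix, noise levels, SINR targets, channel error radii. -/
structure Instance (N M : ℕ) where
  H : Matrix (Fin N) (Fin M) ℂ
  σ : Fin M → ℝ
  γ : Fin M → ℝ
  ε : Fin M → ℝ

variable {N M : ℕ}

/-- Squared Frobenius norm. -/
def power (W : Beam N M) : ℝ := ∑ n, ∑ m, ‖W n m‖ ^ 2

/-- Squared Euclidean norm of a row. -/
def rowPower (W : Beam N M) (n : Fin N) : ℝ := ∑ m, ‖W n m‖ ^ 2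

/-- Number of nonzero rows. -/
def rowZero (W : Beam N M) : ℕ := {n : Fin N | W.row n ≠ 0}.ncard

/-- `w_jᴴ h`. -/
def gain (W : Beam N M) (j : Fin M) (h : Fin N → ℂ) : ℂ := star (W.col j) ⬝ᵥ h

/-- Signal to interference and noise ratio of user `m` when its channel is `h`. -/
def sinr (P : Instance N M) (W : Beam N M) (m : Fin M) (h : Fin N → ℂ) : ℝ :=
  ‖gain W m h‖ ^ 2 / (∑ l ∈ Finset.univ.erase m, ‖gain W l h‖ ^ 2 + P.σ m ^ 2)

/-- The ball of possible channels of user `m`. -/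
def channelBall (P : Instance N M) (m : Fin M) : Set (Fin N → ℂ) :=
  {h | ‖(WithLp.toLp 2 (h - P.H.col m) : EuclideanSpace ℂ (Fin N))‖ ≤ P.ε m}

/-- Feasible set of the joint beamforming and antenna selection problem (perfect CSI). -/
def bfas (P : Instance N M) (L : ℕ) : Set (Beam N M) :=
  {W | (∀ m, P.γ m ≤ sinr P W m (P.H.col m)) ∧ rowZero W ≤ L}

/-- Feasible set of the joint robust beamforming and antenna selection problem
(imperfect CSI). -/
def rbfas (P : Instance N M) (L : ℕ) : Set (Beam N M) :=
  {W | (∀ m, ∀ h ∈ channelBall P m, P.γ m ≤ sinr P W m h) ∧ rowZero W ≤ L}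

/-! ### Convex programs and their solvers -/

structure Program (X : Type) where
  feasible : Set X
  objective : X → ℝ

/-- `solve` returns an (arbitrary) optimal solution of each feasible program of the family
`p`, and `none` for the infeasible ones. -/
def IsSolver {κ X : Type} (p : κ → Program X) (solve : κ → Option X) : Prop :=
  ∀ k, (∀ x, solve k = some x →
      x ∈ (p k).feasible ∧ ∀ y ∈ (p k).feasible, (p k).objective x ≤ (p k).objective y) ∧
    (solve k = none → (p k).feasible = ∅)

/-- Second-order cone form of the SINR constraints. -/
def socConstraint (P : Instance N M) (W : Beam N M) : Prop :=
  ∀ m, √(∑ l ∈ Finset.univ.erase m, ‖gain W l (P.H.col m)‖ ^ 2 + P.σ m ^ 2) ≤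
    1 / √(P.γ m) * (gain W m (P.H.col m)).re

/-- SOCP of beamforming with the antennas in `B` shut down. -/
def socp (P : Instance N M) (B : Finset (Fin N)) : Program (Beam N M) where
  feasible := {W | socConstraint P W ∧ ∀ n ∈ B, W.row n = 0}
  objective := power

/-- Variables of the semidefinite relaxation: one `N × N` matrix per user. -/
abbrev Lifted (N M : ℕ) : Type := Fin M → Matrix (Fin N) (Fin N) ℂ

/-- `hᴴ S h` -/
def quad (S : Matrix (Fin N) (Fin N) ℂ) (h : Fin N → ℂ) : ℝ := (star h ⬝ᵥ (S *ᵥ h)).re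

/-- Lifted worst-case SINR constraints, the rank-one constraint being dropped. -/
def sdrConstraint (P : Instance N M) (S : Lifted N M) : Prop :=
  (∀ m, (S m).PosSemidef) ∧
  ∀ m, ∀ h ∈ channelBall P m,
    P.γ m ≤ quad (S m) h / (∑ l ∈ Finset.univ.erase m, quad (S l) h + P.σ m ^ 2)

/-- Total power `∑ Tr W_m`. -/
def liftedPower (S : Lifted N M) : ℝ := ∑ m, (S m).trace.re

/-- Power that a lifted solution assigns to antenna `n`. -/
def liftedRowPower (S : Lifted N M) (n : Fin N) : ℝ := ∑ m, (S m n n).re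

/-- SDR of robust beamforming with the antennas in `B` shut down. -/
def sdr (P : Instance N M) (B : Finset (Fin N)) : Program (Lifted N M) where
  feasible := {S | sdrConstraint P S ∧ ∀ m, ∀ n ∈ B, (S m).row n = 0}
  objective := liftedPower

open Classical in
/-- Beamformers `w_m` with `W_m = w_m w_mᴴ` if there are any. -/
def extract (S : Lifted N M) : Option (Beam N M) :=
  if h : ∃ W : Beam N M, ∀ m, S m = Matrix.vecMulVec (W.col m) (star (W.col m)) then
    some h.choose
  else none

/-! ### The sufficient condition for tightness of the SDR -/

/-- `I - G (Gᴴ G)⁻¹ Gᴴ` -/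
def complProj {ι κ : Type} [Fintype ι] [DecidableEq ι] [Fintype κ] [DecidableEq κ]
    (G : Matrix ι κ ℂ) : Matrix ι ι ℂ := 1 - G * (Gᴴ * G)⁻¹ * Gᴴ

/-- The condition, for every submatrix `H(S,:)` of at least `L` rows and every user `m`.
`G` is `H(S,:)` without its `m`-th column; `Gᴴ G` has to be invertible for the projector to
make sense. -/
def sdrCondition (P : Instance N M) (L : ℕ) : Prop :=
  ∀ S : Finset (Fin N), L ≤ S.card → ∀ m : Fin M,
    let G : Matrix S {j : Fin M // j ≠ m} ℂ := P.H.submatrix Subtype.val Subtype.val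
    let h : S → ℂ := fun n => P.H n m
    IsUnit (Gᴴ * G).det ∧
    1 + (M : ℝ) + ((M : ℝ) - 1 / (M : ℝ)) * P.γ m <
      ‖(WithLp.toLp 2 (complProj G *ᵥ h) : EuclideanSpace ℂ S)‖ ^ 2 / P.ε m ^ 2

/-! ### Branch and bound -/

/-- A node of the search tree: the activated antennas `A`, the antennas `B` shut down. -/
structure Node (N : ℕ) where
  A : Finset (Fin N)
  B : Finset (Fin N)
deriving DecidableEq

namespace Node

def IsLeaf (L : ℕ) (ν : Node N) : Prop := ν.A.card = L ∧ ν.B.card = N - L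

/-- Decides the remaining antennas once `L` are activated or `N - L` are shut down. -/
def complete (L : ℕ) (ν : Node N) : Node N :=
  if ν.A.card = L then ⟨ν.A, ν.Aᶜ⟩
  else if ν.B.card = N - L then ⟨ν.Bᶜ, ν.B⟩
  else ν

/-- Nothing is decided (unless `L = N`, when there is nothing to decide). -/
def root (N L : ℕ) : Node N := complete L ⟨∅, ∅⟩

def left (L : ℕ) (ν : Node N) (n : Fin N) : Node N := complete L ⟨ν.A, insert n ν.B⟩

def right (L : ℕ) (ν : Node N) (n : Fin N) : Node N := complete L ⟨insert n ν.A, ν.B⟩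

def undecided (ν : Node N) : Finset (Fin N) := (ν.A ∪ ν.B)ᶜ

end Node

/-- What distinguishes the branch-and-bound methods. `κ` indexes the convex programs that are
handed to the solver, `X` is the type of their solutions. -/
structure Method (N M : ℕ) (κ X : Type) where
  /-- The solver. -/
  solve : κ → Option X
  /-- Objective value of a solution. -/
  value : X → ℝ
  /-- The beamforming matrix read off a solution, if there is one. -/
  beam : X → Option (Beam N M)
  /-- The program for the lower bound at a node. -/
  lbKey : Node N → κ
  /-- The program for the upper bound that shuts down exactly the given antennas. -/
  ubKey : Finset (Fin N) → κ
  /-- Admissible branching antennas, given the lower bound solution at the node. -/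
  mayBranch : Node N → X → Fin N → Prop
  /-- Admissible sets to shut down in the upper bound, given the lower bound solution. -/
  mayExclude : Node N → X → Finset (Fin N) → Prop

/-- State of a run. `cache` holds the programs solved so far, whose solutions are stored and
reused; `calls` counts the programs handed to the solver. -/
structure State (N M : ℕ) (κ : Type) where
  frontier : Finset (Node N)
  incumbent : Option (Beam N M)
  upper : ℝ≥0∞
  lower : ℝ≥0∞
  cache : Finset κ
  calls : ℕ

/-- Objective value of an optional beamforming matrix, `+∞` if there is none. -/
def cost : Option (Beam N M) → ℝ≥0∞
  | some W => ENNReal.ofReal (power W)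
  | none => ⊤

/-- Look up one program: it is solved only if it is not in the cache. -/
def query {κ : Type} [DecidableEq κ] (c : Finset κ × ℕ) (k : κ) : Finset κ × ℕ :=
  if k ∈ c.1 then c else (insert k c.1, c.2 + 1)

/-- `|u - l| / l`, with the value `0` for `u = l = +∞`. -/
def relGap (u l : ℝ≥0∞) : ℝ≥0∞ := ((u - l) + (l - u)) / l

namespace Method

variable {κ X : Type} [DecidableEq κ]

/-- Lower bound at a node, `+∞` if the program is infeasible. -/
def lb (E : Method N M κ X) (ν : Node N) : ℝ≥0∞ :=
  match E.solve (E.lbKey ν) with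
  | some x => ENNReal.ofReal (E.value x)
  | none => ⊤

/-- `o` is the set of `N - L` antennas that the upper bound at `ν` shuts down: those already
shut down and some undecided ones. No upper bound program is solved (`o = none`) if already
the lower bound program is infeasible. -/
def Excludes (E : Method N M κ X) (L : ℕ) (ν : Node N) : Option (Finset (Fin N)) → Prop
  | some T => ν.B ⊆ T ∧ T ⊆ ν.B ∪ ν.undecided ∧ T.card = N - L ∧
      ∃ x, E.solve (E.lbKey ν) = some x ∧ E.mayExclude ν x T
  | none => E.solve (E.lbKey ν) = none

/-- The beamforming matrix of the upper bound. -/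
def ubBeam (E : Method N M κ X) (o : Option (Finset (Fin N))) : Option (Beam N M) :=
  o.bind fun T => (E.solve (E.ubKey T)).bind E.beam

/-- Computes the lower and then the upper bound at `ν`, as far as cache and calls go. -/
def evaluate (E : Method N M κ X) (c : Finset κ × ℕ) (ν : Node N)
    (o : Option (Finset (Fin N))) : Finset κ × ℕ :=
  match o with
  | some T => query (query c (E.lbKey ν)) (E.ubKey T)
  | none => query c (E.lbKey ν)

/-- Initial states. -/
def Initial (E : Method N M κ X) (L : ℕ) (s : State N M κ) : Prop :=
  ∃ o, E.Excludes L (Node.root N L) o ∧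
    s = { frontier := {Node.root N L}
          incumbent := E.ubBeam o
          upper := cost (E.ubBeam o)
          lower := E.lb (Node.root N L)
          cache := (E.evaluate (∅, 0) (Node.root N L) o).1
          calls := (E.evaluate (∅, 0) (Node.root N L) o).2 }

/-- The stopping criterion with relative tolerance `tol`. -/
def Halted (tol : ℝ≥0) (s : State N M κ) : Prop :=
  s.frontier = ∅ ∨ relGap s.upper s.lower ≤ tol

/-- The state after branching `ν` into `ν₁` and `ν₂`, where `W` is the better one of the
upper bound solutions of the two children and `c` is the new content of cache and counter. -/
def next (E : Method N M κ X) (s : State N M κ) (ν ν₁ ν₂ : Node N) (W : Option (Beam N M))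
    (c : Finset κ × ℕ) : State N M κ :=
  let F : Finset (Node N) := insert ν₁ (insert ν₂ (s.frontier.erase ν))
  let u : ℝ≥0∞ := if cost W ≤ s.upper then cost W else s.upper
  { frontier := F.filter fun ν' => E.lb ν' ≤ u
    incumbent := if cost W ≤ s.upper then W else s.incumbent
    upper := u
    lower := F.inf E.lb
    cache := c.1
    calls := c.2 }

/-- One iteration: a non-leaf node of lowest lower bound is branched. All ties (node,
branching antenna, sets shut down, better child) may be broken in any way. -/
def Step (E : Method N M κ X) (L : ℕ) (tol : ℝ≥0) (s s' : State N M κ) : Prop :=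
  ¬ Halted tol s ∧
  ∃ ν ∈ s.frontier, ¬ ν.IsLeaf L ∧
    (∀ ν' ∈ s.frontier, ¬ ν'.IsLeaf L → E.lb ν ≤ E.lb ν') ∧
  ∃ x, E.solve (E.lbKey ν) = some x ∧
  ∃ n ∈ ν.undecided, E.mayBranch ν x n ∧
  ∃ o₁ o₂, E.Excludes L (ν.left L n) o₁ ∧ E.Excludes L (ν.right L n) o₂ ∧
  ∃ W, (W = E.ubBeam o₁ ∨ W = E.ubBeam o₂) ∧
    cost W ≤ cost (E.ubBeam o₁) ∧ cost W ≤ cost (E.ubBeam o₂) ∧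
  s' = E.next s ν (ν.left L n) (ν.right L n) W
    (E.evaluate (E.evaluate (s.cache, s.calls) (ν.left L n) o₁) (ν.right L n) o₂)

/-- States that occur in some run. -/
def Reachable (E : Method N M κ X) (L : ℕ) (tol : ℝ≥0) (s : State N M κ) : Prop :=
  ∃ s₀, E.Initial L s₀ ∧ Relation.ReflTransGen (E.Step L tol) s₀ s

/-- The method can be started and has no infinite run. -/
def Terminates (E : Method N M κ X) (L : ℕ) (tol : ℝ≥0) : Prop :=
  (∃ s, E.Initial L s) ∧
  ¬ ∃ s : ℕ → State N M κ, E.Initial L (s 0) ∧ ∀ t, E.Step L tol (s t) (s (t + 1))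

/-- Every run is finite, does not stop before the stopping criterion is met, and then returns
a global minimizer of `power` on `feas`, up to the factor `1 + tol` (so an exact one for
`tol = 0`); it returns nothing only if `feas` is empty. -/
def SolvesOptimally (E : Method N M κ X) (L : ℕ) (tol : ℝ≥0) (feas : Set (Beam N M)) : Prop :=
  E.Terminates L tol ∧
  (∀ s, E.Reachable L tol s → ¬ Halted tol s → ∃ s', E.Step L tol s s') ∧
  ∀ s, E.Reachable L tol s → Halted tol s →
    (∀ W, s.incumbent = some W →
      W ∈ feas ∧ ∀ W' ∈ feas, power W ≤ (1 + (tol : ℝ)) * power W') ∧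
    (s.incumbent = none → feas = ∅)

/-- Every run is finite and hands at most `Q` programs to the solver. -/
def SolvesAtMost (E : Method N M κ X) (L : ℕ) (tol : ℝ≥0) (Q : ℕ) : Prop :=
  E.Terminates L tol ∧ ∀ s, E.Reachable L tol s → s.calls ≤ Q

end Method

/-- Branch on an undecided antenna of largest power `p`. -/
def branchLargest {X : Type} (p : X → Fin N → ℝ) (ν : Node N) (x : X) (n : Fin N) : Prop :=
  ∀ i ∈ ν.undecided, p x i ≤ p x n

/-- Shut down undecided antennas of smallest power `p`. -/
def excludeSmallest {X : Type} (p : X → Fin N → ℝ) (ν : Node N) (x : X)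
    (T : Finset (Fin N)) : Prop :=
  ∀ i ∈ T \ ν.B, ∀ j ∈ ν.undecided \ T, p x i ≤ p x j

/-- The proposed method for perfect CSI. -/
def socpBB (solve : Finset (Fin N) → Option (Beam N M)) :
    Method N M (Finset (Fin N)) (Beam N M) where
  solve := solve
  value := power
  beam := some
  lbKey := Node.B
  ubKey := id
  mayBranch := branchLargest rowPower
  mayExclude := excludeSmallest rowPower

/-- The proposed method for imperfect CSI. -/
def sdrBB (solve : Finset (Fin N) → Option (Lifted N M)) :
    Method N M (Finset (Fin N)) (Lifted N M) where
  solve := solve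
  value := liftedPower
  beam := extract
  lbKey := Node.B
  ubKey := id
  mayBranch := branchLargest liftedRowPower
  mayExclude := excludeSmallest liftedRowPower

/-! ### The alternative method with relaxed Boolean variables -/

/-- Constraints on the relaxed Boolean variables at a node. -/
def boolRelaxed (L : ℕ) (ν : Node N) (z : Fin N → ℝ) : Prop :=
  (∀ n, 0 ≤ z n ∧ z n ≤ 1) ∧ ∑ n, z n ≤ L ∧ (∀ n ∈ ν.B, z n = 0) ∧ ∀ n ∈ ν.A, z n = 1

/-- Relaxed node problem, perfect CSI. -/
def bigMSocp (P : Instance N M) (L : ℕ) (C : ℝ) (ν : Node N) :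
    Program (Beam N M × (Fin N → ℝ)) where
  feasible := {Y | socConstraint P Y.1 ∧ boolRelaxed L ν Y.2 ∧
    ∀ n, √(rowPower Y.1 n) ≤ C * Y.2 n}
  objective := fun Y => power Y.1

/-- Relaxed node problem, imperfect CSI. The row constraint `‖W(n,:)‖ ≤ C z(n)`, which for
Boolean `z` says `‖W(n,:)‖² ≤ C² z(n)`, is lifted in the latter form, which is convex. -/
def bigMSdr (P : Instance N M) (L : ℕ) (C : ℝ) (ν : Node N) :
    Program (Lifted N M × (Fin N → ℝ)) where
  feasible := {Y | sdrConstraint P Y.1 ∧ boolRelaxed L ν Y.2 ∧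
    ∀ n, liftedRowPower Y.1 n ≤ C ^ 2 * Y.2 n}
  objective := fun Y => liftedPower Y.1

/-- The alternative method, perfect CSI, with any choice of branching antennas and of
antennas to shut down. The upper bound is the node problem with all Boolean variables fixed. -/
def bigMSocpBB (solve : Node N → Option (Beam N M × (Fin N → ℝ))) :
    Method N M (Node N) (Beam N M × (Fin N → ℝ)) where
  solve := solve
  value := fun Y => power Y.1
  beam := fun Y => some Y.1
  lbKey := id
  ubKey := fun T => ⟨Tᶜ, T⟩
  mayBranch := fun _ _ _ => True
  mayExclude := fun _ _ _ => True

/-- The alternative method, imperfect CSI. -/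
def bigMSdrBB (solve : Node N → Option (Lifted N M × (Fin N → ℝ))) :
    Method N M (Node N) (Lifted N M × (Fin N → ℝ)) where
  solve := solve
  value := fun Y => liftedPower Y.1
  beam := fun Y => extract Y.1
  lbKey := id
  ubKey := fun T => ⟨Tᶜ, T⟩
  mayBranch := fun _ _ _ => True
  mayExclude := fun _ _ _ => True

end BFAS

end

/-! Optimality of the search. Every feasible beamforming matrix vanishes on some set T of N - L
antennas, so the problem is to find the cheapest program that shuts down such a T. `ExactOnLeaves`
collects what is needed of the programs: at a T of size N - L a solution yields a feasible
beamforming matrix of the same power, the value grows with the set shut down, and these programs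
together relax the problem. The search then preserves `SearchInvariant`: each T is compatible with
an unbranched node or is strictly worse than the incumbent. Hence the lower bound never exceeds any
of the values, nor the upper bound. As both bounds agree at a leaf, a node that attains a lower
bound strictly below the upper bound is no leaf and can be branched. A halted run therefore has a
small gap, and termination follows from a weight on the unbranched nodes.

Exactness with perfect CSI is a rotation of phases (`exists_socConstraint`). With imperfect CSI it
is rank one of every optimal solution at a leaf (`exists_eq_vecMulVec_of_optimal`), proved by
exchange. Zero-forcing gives unit vectors v_j that are orthogonal to the other users' channels and
satisfy v_jᴴ h_j = R_j = ‖Π_j h̃_j‖. For user m, `exists_rankOne_add` splits W_m = aaᴴ + D with D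
annihilating h_m - k v_m. If d = Tr D > 0, drop D and add dτ v_j v_jᴴ for every user j. The power
changes by d(Mτ - 1), which is negative for τ < 1/M. On the ball around h_m, D sees only e + k v_m,
so the lost signal is at most d‖e + k v_m‖². The best k is R_m/(M+1), and then the stated condition
on R_m²/ε_m² is precisely what leaves room for some τ < 1/M (`exists_perturbation`). This
contradicts optimality.

Counting. The programs at leaves number at most C(N, L). A potential argument (`CountBound`) bounds
the others. In the proposed method an activating child either has its parent's program or is a leaf,
so only a shutting-down child can need a new program besides those of the leaves; Pascal's rule
gives at most C(N-1, L) of them for L < N, which equals the stated sum by the hockey-stick identity.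
In the alternative method the other programs belong to internal nodes of a binary tree with C(N, L)
leaves, at most C(N, L) - 1. -/

namespace BFAS

variable {N M L : ℕ}

/-! ### Nodes of the search tree -/

namespace Node

/-- The nodes that occur in a run: either all antennas are decided, or neither of the two
sets is full yet. -/
def Valid (L : ℕ) (ν : Node N) : Prop :=
  Disjoint ν.A ν.B ∧
    ((ν.A.card = L ∧ ν.B.card = N - L ∧ ν.B = ν.Aᶜ) ∨ (ν.A.card < L ∧ ν.B.card < N - L))

/-- Shutting down exactly the antennas in `T` agrees with the decisions made at `ν`. -/
def Compatible (ν : Node N) (T : Finset (Fin N)) : Prop := ν.B ⊆ T ∧ Disjoint ν.A T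

theorem mem_undecided {ν : Node N} {n : Fin N} : n ∈ ν.undecided ↔ n ∉ ν.A ∧ n ∉ ν.B := by
  simp [undecided]

theorem complete_of_card_A (ν : Node N) (h : ν.A.card = L) : ν.complete L = ⟨ν.A, ν.Aᶜ⟩ := by
  simp [complete, h]

theorem complete_of_card_B (ν : Node N) (h : ν.A.card ≠ L) (h' : ν.B.card = N - L) :
    ν.complete L = ⟨ν.Bᶜ, ν.B⟩ := by
  simp [complete, h, h']

theorem complete_of_lt (ν : Node N) (h : ν.A.card < L) (h' : ν.B.card < N - L) :
    ν.complete L = ν := by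
  simp [complete, h.ne, h'.ne]

theorem valid_complete (hLN : L ≤ N) (ν : Node N) (hd : Disjoint ν.A ν.B) (hA : ν.A.card ≤ L)
    (hB : ν.B.card ≤ N - L) : (ν.complete L).Valid L := by
  by_cases h : ν.A.card = L
  · rw [complete_of_card_A ν h]
    exact ⟨disjoint_compl_right, Or.inl ⟨h, by simp [Finset.card_compl, h], rfl⟩⟩
  by_cases h' : ν.B.card = N - L
  · rw [complete_of_card_B ν h h']
    refine ⟨disjoint_compl_left, Or.inl ⟨?_, h', by simp⟩⟩
    simp only [Finset.card_compl, Fintype.card_fin]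
    omega
  · rw [complete_of_lt ν (by omega) (by omega)]
    exact ⟨hd, Or.inr ⟨by omega, by omega⟩⟩

/-- Once one of the two sets is full, inclusion and equal cardinality force A = Tᶜ or B = T, so the
automatic completion cannot exclude T. -/
theorem Compatible.complete {ν : Node N} {T : Finset (Fin N)} (h : ν.Compatible T)
    (hLN : L ≤ N) (hT : T.card = N - L) : (ν.complete L).Compatible T := by
  by_cases hA : ν.A.card = L
  · rw [complete_of_card_A ν hA]
    refine ⟨?_, h.2⟩
    have h1 : ν.A ⊆ Tᶜ := Finset.subset_compl_iff_disjoint_right.2 h.2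
    have h2 : ν.A = Tᶜ := Finset.eq_of_subset_of_card_le h1 (by
      simp only [Finset.card_compl, Fintype.card_fin]; omega)
    simp [h2]
  by_cases hB : ν.B.card = N - L
  · rw [complete_of_card_B ν hA hB]
    have h2 : ν.B = T := Finset.eq_of_subset_of_card_le h.1 (by omega)
    exact ⟨h.1, by simp [h2, disjoint_compl_left]⟩
  · simpa [Node.complete, hA, hB] using h

theorem valid_root (hLN : L ≤ N) : (root N L).Valid L :=
  valid_complete hLN _ (by simp) (by simp) (by simp)

theorem compatible_root (hLN : L ≤ N) {T : Finset (Fin N)} (hT : T.card = N - L) :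
    (root N L).Compatible T :=
  Compatible.complete ⟨by simp, by simp⟩ hLN hT

theorem Valid.lt_of_not_isLeaf {ν : Node N} (h : ν.Valid L) (hl : ¬ ν.IsLeaf L) :
    ν.A.card < L ∧ ν.B.card < N - L := by
  rcases h.2 with h | h
  · exact absurd ⟨h.1, h.2.1⟩ hl
  · exact h

theorem Valid.card_B_le {ν : Node N} (h : ν.Valid L) : ν.B.card ≤ N - L := by
  rcases h.2 with h | h
  · exact h.2.1.le
  · exact h.2.le

theorem Valid.card_A_le {ν : Node N} (h : ν.Valid L) : ν.A.card ≤ L := by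
  rcases h.2 with h | h
  · exact h.1.le
  · exact h.1.le

theorem card_undecided {ν : Node N} (h : Disjoint ν.A ν.B) :
    ν.undecided.card + ν.A.card + ν.B.card = N := by
  have h1 := Finset.card_add_card_compl (ν.A ∪ ν.B)
  rw [Finset.card_union_of_disjoint h] at h1
  simp only [Fintype.card_fin] at h1
  simp only [undecided]
  omega

theorem Valid.left {ν : Node N} (hLN : L ≤ N) (h : ν.Valid L) (hl : ¬ ν.IsLeaf L) {n : Fin N}
    (hn : n ∈ ν.undecided) : (ν.left L n).Valid L := by
  rw [mem_undecided] at hn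
  have := h.lt_of_not_isLeaf hl
  refine valid_complete hLN _ ?_ this.1.le ?_
  · simpa [Finset.disjoint_insert_right, hn.1] using h.1
  · simpa [Finset.card_insert_of_notMem hn.2] using this.2

theorem Valid.right {ν : Node N} (hLN : L ≤ N) (h : ν.Valid L) (hl : ¬ ν.IsLeaf L) {n : Fin N}
    (hn : n ∈ ν.undecided) : (ν.right L n).Valid L := by
  rw [mem_undecided] at hn
  have := h.lt_of_not_isLeaf hl
  refine valid_complete hLN _ ?_ ?_ this.2.le
  · simpa [Finset.disjoint_insert_left, hn.2] using h.1
  · simpa [Finset.card_insert_of_notMem hn.1] using this.1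

/-- The child that treats n as T does inherits compatibility; branching thus loses no candidate. -/
theorem Compatible.left_or_right {ν : Node N} {T : Finset (Fin N)} (h : ν.Compatible T)
    (hLN : L ≤ N) (hT : T.card = N - L) (n : Fin N) :
    (ν.left L n).Compatible T ∨ (ν.right L n).Compatible T := by
  by_cases hn : n ∈ T
  · exact Or.inl (Compatible.complete ⟨Finset.insert_subset hn h.1, h.2⟩ hLN hT)
  · exact Or.inr (Compatible.complete ⟨h.1, Finset.disjoint_insert_left.2 ⟨hn, h.2⟩⟩ hLN hT)

theorem undecided_complete_subset (ν : Node N) : (ν.complete L).undecided ⊆ ν.undecided := by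
  unfold complete
  split_ifs <;> simp [undecided]

theorem card_undecided_left_lt {ν : Node N} {n : Fin N} (hn : n ∈ ν.undecided) :
    (ν.left L n).undecided.card < ν.undecided.card := by
  refine Finset.card_lt_card ((Finset.ssubset_iff_of_subset ?_).2 ⟨n, hn, fun h => ?_⟩)
  · refine (undecided_complete_subset _).trans fun i hi => ?_
    simp only [mem_undecided, Finset.mem_insert] at hi ⊢
    tauto
  · simpa [mem_undecided] using undecided_complete_subset _ h

theorem card_undecided_right_lt {ν : Node N} {n : Fin N} (hn : n ∈ ν.undecided) :
    (ν.right L n).undecided.card < ν.undecided.card := by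
  refine Finset.card_lt_card ((Finset.ssubset_iff_of_subset ?_).2 ⟨n, hn, fun h => ?_⟩)
  · refine (undecided_complete_subset _).trans fun i hi => ?_
    simp only [mem_undecided, Finset.mem_insert] at hi ⊢
    tauto
  · simpa [mem_undecided] using undecided_complete_subset _ h

end Node

/-! ### Choosing a set of given size -/

theorem exists_smallest_subset {α : Type*} [DecidableEq α] (U : Finset α) (f : α → ℝ) (k : ℕ)
    (hk : k ≤ U.card) : ∃ V ⊆ U, V.card = k ∧ ∀ i ∈ V, ∀ j ∈ U \ V, f i ≤ f j := by
  induction k with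
  | zero => exact ⟨∅, by simp⟩
  | succ k ih =>
    obtain ⟨V, hVU, hV, h⟩ := ih (by omega)
    have hne : (U \ V).Nonempty := by
      rw [← Finset.card_pos, Finset.card_sdiff_of_subset hVU]
      omega
    obtain ⟨a, ha, hmin⟩ := Finset.exists_min_image (U \ V) f hne
    obtain ⟨haU, haV⟩ := Finset.mem_sdiff.1 ha
    refine ⟨insert a V, Finset.insert_subset haU hVU, by
      rw [Finset.card_insert_of_notMem haV, hV], fun i hi j hj => ?_⟩
    have hj' : j ∈ U \ V := by
      simp only [Finset.mem_sdiff, Finset.mem_insert, not_or] at hj ⊢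
      exact ⟨hj.1, hj.2.2⟩
    rcases Finset.mem_insert.1 hi with rfl | hi
    · exact hmin j hj'
    · exact h i hi j hj'

theorem Node.Valid.exists_exclude {X : Type} {ν : Node N} (h : ν.Valid L) (p : X → Fin N → ℝ)
    (x : X) : ∃ T, ν.B ⊆ T ∧ T ⊆ ν.B ∪ ν.undecided ∧ T.card = N - L ∧ excludeSmallest p ν x T := by
  have hc := Node.card_undecided h.1
  have hA := h.card_A_le
  have hB := h.card_B_le
  obtain ⟨V, hVU, hV, hmin⟩ :=
    exists_smallest_subset ν.undecided (p x) (N - L - ν.B.card) (by omega)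
  have hd : Disjoint ν.B V := Finset.disjoint_left.2 fun i hi hiV =>
    (Node.mem_undecided.1 (hVU hiV)).2 hi
  refine ⟨ν.B ∪ V, Finset.subset_union_left, Finset.union_subset_union_right hVU, ?_, ?_⟩
  · rw [Finset.card_union_of_disjoint hd]; omega
  · intro i hi j hj
    simp only [Finset.mem_sdiff, Finset.mem_union, not_or] at hi hj
    exact hmin i (by tauto) j (by simp only [Finset.mem_sdiff]; tauto)

namespace Method

variable {κ X : Type}

/-! ### Termination -/

theorem exists_excludes (E : Method N M κ X) {ν : Node N}
    (h : ∀ x, ∃ T, ν.B ⊆ T ∧ T ⊆ ν.B ∪ ν.undecided ∧ T.card = N - L ∧ E.mayExclude ν x T) :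
    ∃ o, E.Excludes L ν o := by
  cases hs : E.solve (E.lbKey ν) with
  | none => exact ⟨none, hs⟩
  | some x =>
    obtain ⟨T, h1, h2, h3, h4⟩ := h x
    exact ⟨some T, h1, h2, h3, x, hs, h4⟩

/-- Strictly decreasing along every run. -/
def searchSize (s : State N M κ) : ℕ := ∑ ν ∈ s.frontier, 3 ^ ν.undecided.card

theorem sum_insert_le {α : Type*} [DecidableEq α] (a : α) (F : Finset α) (f : α → ℕ) :
    ∑ i ∈ insert a F, f i ≤ f a + ∑ i ∈ F, f i := by
  by_cases h : a ∈ F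
  · simp [Finset.insert_eq_of_mem h]
  · rw [Finset.sum_insert h]

/-- Accounting shared by termination and counting. It is only an inequality because pruning removes
nodes and a child might coincide with a node already present. -/
theorem sum_frontier_next_le (E : Method N M κ X) (s : State N M κ) {ν : Node N} (ν₁ ν₂ : Node N)
    (W : Option (Beam N M)) (c : Finset κ × ℕ) (hν : ν ∈ s.frontier) (f : Node N → ℕ) :
    ∑ ν' ∈ (E.next s ν ν₁ ν₂ W c).frontier, f ν' + f ν ≤
      f ν₁ + f ν₂ + ∑ ν' ∈ s.frontier, f ν' := by
  have h1 : ∑ ν' ∈ (E.next s ν ν₁ ν₂ W c).frontier, f ν' ≤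
      ∑ ν' ∈ insert ν₁ (insert ν₂ (s.frontier.erase ν)), f ν' :=
    Finset.sum_le_sum_of_subset (Finset.filter_subset _ _)
  have h2 := sum_insert_le ν₁ (insert ν₂ (s.frontier.erase ν)) f
  have h3 := sum_insert_le ν₂ (s.frontier.erase ν) f
  have h4 := Finset.sum_erase_add s.frontier f hν
  omega

variable [DecidableEq κ]

theorem searchSize_lt_of_step {E : Method N M κ X} {tol : ℝ≥0} {s s' : State N M κ}
    (h : E.Step L tol s s') : searchSize s' < searchSize s := by
  obtain ⟨-, ν, hν, -, -, x, -, n, hn, -, o₁, o₂, -, -, W, -, -, -, rfl⟩ := h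
  have h1 := E.sum_frontier_next_le s (ν.left L n) (ν.right L n) W
    (E.evaluate (E.evaluate (s.cache, s.calls) (ν.left L n) o₁) (ν.right L n) o₂) hν
    (fun ν => 3 ^ ν.undecided.card)
  have h2 := Node.card_undecided_left_lt (L := L) hn
  have h3 := Node.card_undecided_right_lt (L := L) hn
  -- Both children have at most k undecided antennas, and 2 · 3^k < 3^(k+1): this is why the weight
  -- has base 3.
  obtain ⟨k, hk⟩ : ∃ k, ν.undecided.card = k + 1 := ⟨_, (Nat.succ_pred (by omega)).symm⟩
  have h4 : 3 ^ (ν.left L n).undecided.card ≤ 3 ^ k := Nat.pow_le_pow_right (by norm_num) (by omega)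
  have h5 : 3 ^ (ν.right L n).undecided.card ≤ 3 ^ k :=
    Nat.pow_le_pow_right (by norm_num) (by omega)
  have h6 : 0 < 3 ^ k := by positivity
  simp only [hk, pow_succ] at h1
  unfold searchSize
  omega

theorem terminates {E : Method N M κ X} (tol : ℝ≥0) (h : ∃ o, E.Excludes L (Node.root N L) o) :
    E.Terminates L tol := by
  refine ⟨?_, ?_⟩
  · obtain ⟨o, ho⟩ := h
    exact ⟨_, o, ho, rfl⟩
  · rintro ⟨s, -, hs⟩
    have key : ∀ t, searchSize (s t) + t ≤ searchSize (s 0) := by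
      intro t
      induction t with
      | zero => simp
      | succ t ih => have := searchSize_lt_of_step (hs t); omega
    have := key (searchSize (s 0) + 1)
    omega

/-! ### Counting the programs solved -/

theorem query_spec {c : Finset κ × ℕ} (hc : c.2 = c.1.card) (k : κ) :
    (query c k).1 = insert k c.1 ∧ (query c k).2 = (query c k).1.card := by
  unfold query
  split_ifs with h
  · exact ⟨(Finset.insert_eq_of_mem h).symm, hc⟩
  · exact ⟨rfl, by simp [Finset.card_insert_of_notMem h, hc]⟩

/-- Upper bound programs lie in K, so the node's own lower bound program is the only one outside K
that an evaluation can add. -/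
theorem evaluate_spec (E : Method N M κ X) {K : Finset κ}
    (hK : ∀ T : Finset (Fin N), T.card = N - L → E.ubKey T ∈ K) {c : Finset κ × ℕ}
    (hc : c.2 = c.1.card) {ν : Node N} {o : Option (Finset (Fin N))} (ho : E.Excludes L ν o) :
    (E.evaluate c ν o).2 = (E.evaluate c ν o).1.card ∧ insert (E.lbKey ν) c.1 ⊆ (E.evaluate c ν o).1 ∧
      (E.evaluate c ν o).1 ⊆ insert (E.lbKey ν) c.1 ∪ K := by
  obtain ⟨h1, h2⟩ := query_spec hc (E.lbKey ν)
  cases o with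
  | none => exact ⟨h2, h1.ge, h1.le.trans Finset.subset_union_left⟩
  | some T =>
    obtain ⟨h3, h4⟩ := query_spec h2 (E.ubKey T)
    rw [h1] at h3
    refine ⟨h4, h3.ge.trans' (Finset.subset_insert _ _), h3.le.trans ?_⟩
    exact Finset.insert_subset (Finset.mem_union_right _ (hK T ho.2.2.1)) Finset.subset_union_left

/-- What the counting argument needs: `K` contains the programs of the leaves, and `g ν` bounds
the number of other programs that are yet to be solved below `ν`. -/
structure CountBound (E : Method N M κ X) (L : ℕ) (K : Finset κ) (g : Node N → ℕ) : Prop where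
  ub_mem : ∀ T : Finset (Fin N), T.card = N - L → E.ubKey T ∈ K
  branch : ∀ ν : Node N, ν.Valid L → ¬ ν.IsLeaf L → ∀ n ∈ ν.undecided,
    (({E.lbKey (ν.left L n), E.lbKey (ν.right L n)} : Finset κ) \ insert (E.lbKey ν) K).card +
      g (ν.left L n) + g (ν.right L n) ≤ g ν

/-- `bound` is a budget: programs outside K solved so far, plus what is reserved for the unbranched
nodes, never exceed the initial amount. `mem_cache` is what allows `CountBound.branch` to treat the
parent's program as free. -/
structure CountInvariant (E : Method N M κ X) (L : ℕ) (K : Finset κ) (g : Node N → ℕ)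
    (s : State N M κ) : Prop where
  valid : ∀ ν ∈ s.frontier, ν.Valid L
  calls_eq : s.calls = s.cache.card
  mem_cache : ∀ ν ∈ s.frontier, E.lbKey ν ∈ s.cache
  bound : (s.cache \ K).card + ∑ ν ∈ s.frontier, g ν ≤
    (({E.lbKey (Node.root N L)} : Finset κ) \ K).card + g (Node.root N L)

theorem CountBound.invariant_of_initial {E : Method N M κ X} {K : Finset κ} {g : Node N → ℕ}
    (hE : E.CountBound L K g) (hLN : L ≤ N) {s : State N M κ} (hs : E.Initial L s) :
    E.CountInvariant L K g s := by
  obtain ⟨o, ho, rfl⟩ := hs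
  obtain ⟨h1, h2, h3⟩ := E.evaluate_spec hE.ub_mem (c := (∅, 0)) (by simp) ho
  refine ⟨?_, h1, ?_, ?_⟩
  · simpa using Node.valid_root hLN
  · simpa using h2 (Finset.mem_insert_self _ _)
  · simp only [Finset.sum_singleton]
    refine Nat.add_le_add_right (Finset.card_le_card fun k hk => ?_) _
    rw [Finset.mem_sdiff] at hk ⊢
    have := h3 hk.1
    simp only [Finset.mem_union, Finset.mem_insert, Finset.notMem_empty, or_false] at this
    exact ⟨by simpa using this.resolve_right hk.2, hk.2⟩

theorem CountInvariant.step {E : Method N M κ X} {K : Finset κ} {g : Node N → ℕ} {tol : ℝ≥0}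
    (hE : E.CountBound L K g) (hLN : L ≤ N) {s s' : State N M κ} (hs : E.CountInvariant L K g s)
    (h : E.Step L tol s s') : E.CountInvariant L K g s' := by
  obtain ⟨-, ν, hν, hl, -, x, -, n, hn, -, o₁, o₂, ho₁, ho₂, W, -, -, -, rfl⟩ := h
  have hv := hs.valid ν hν
  obtain ⟨a1, a2, a3⟩ := E.evaluate_spec hE.ub_mem (c := (s.cache, s.calls)) hs.calls_eq ho₁
  obtain ⟨b1, b2, b3⟩ := E.evaluate_spec hE.ub_mem a1 ho₂
  set c₁ := E.evaluate (s.cache, s.calls) (ν.left L n) o₁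
  set c₂ := E.evaluate c₁ (ν.right L n) o₂
  have hF : ∀ ν' ∈ (E.next s ν (ν.left L n) (ν.right L n) W c₂).frontier,
      ν' = ν.left L n ∨ ν' = ν.right L n ∨ ν' ∈ s.frontier := by
    intro ν' h'
    have := (Finset.mem_filter.1 h').1
    simp only [Finset.mem_insert, Finset.mem_erase] at this
    tauto
  refine ⟨?_, b1, ?_, ?_⟩
  · intro ν' h'
    rcases hF ν' h' with rfl | rfl | h'
    · exact hv.left hLN hl hn
    · exact hv.right hLN hl hn
    · exact hs.valid _ h'
  · intro ν' h'
    change _ ∈ c₂.1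
    rcases hF ν' h' with rfl | rfl | h'
    · exact b2 (Finset.mem_insert_of_mem (a2 (Finset.mem_insert_self _ _)))
    · exact b2 (Finset.mem_insert_self _ _)
    · exact b2 (Finset.mem_insert_of_mem (a2 (Finset.mem_insert_of_mem (hs.mem_cache _ h'))))
  · have h1 := E.sum_frontier_next_le s (ν.left L n) (ν.right L n) W c₂ hν g
    have h2 := hE.branch ν hv hl n hn
    have h3 : (c₂.1 \ K).card ≤ (s.cache \ K).card +
        (({E.lbKey (ν.left L n), E.lbKey (ν.right L n)} : Finset κ) \ insert (E.lbKey ν) K).card := by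
      refine (Finset.card_le_card fun k hk => ?_).trans (Finset.card_union_le _ _)
      rw [Finset.mem_sdiff] at hk
      have h4 := b3 hk.1
      have h5 := @a3 k
      have h6 := hs.mem_cache ν hν
      simp only [Finset.mem_union, Finset.mem_insert, Finset.mem_sdiff, Finset.mem_singleton]
        at h4 h5 ⊢
      by_cases h7 : k = E.lbKey ν
      · subst h7; tauto
      · tauto
    have h4 := hs.bound
    change (c₂.1 \ K).card + _ ≤ _
    omega

theorem CountBound.invariant_of_reachable {E : Method N M κ X} {K : Finset κ} {g : Node N → ℕ}
    {tol : ℝ≥0} (hE : E.CountBound L K g) (hLN : L ≤ N) {s : State N M κ}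
    (hs : E.Reachable L tol s) : E.CountInvariant L K g s := by
  obtain ⟨s₀, h0, h⟩ := hs
  induction h with
  | refl => exact hE.invariant_of_initial hLN h0
  | tail _ h ih => exact ih.step hE hLN h

theorem CountBound.solvesAtMost {E : Method N M κ X} {K : Finset κ} {g : Node N → ℕ} {Q : ℕ}
    (hE : E.CountBound L K g) (hLN : L ≤ N) (tol : ℝ≥0)
    (hex : ∃ o, E.Excludes L (Node.root N L) o)
    (hQ : K.card + ((({E.lbKey (Node.root N L)} : Finset κ) \ K).card + g (Node.root N L)) ≤ Q) :
    E.SolvesAtMost L tol Q := by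
  refine ⟨terminates tol hex, fun s hs => ?_⟩
  have h := hE.invariant_of_reachable hLN hs
  have h1 : s.cache.card ≤ K.card + (s.cache \ K).card := by
    refine (Finset.card_le_card fun k hk => ?_).trans (Finset.card_union_le _ _)
    by_cases h : k ∈ K <;> simp [h, hk]
  have h2 := h.bound
  rw [h.calls_eq]
  omega

end Method

/-! ### Number of programs solved by the two kinds of methods -/

/-- The method that relaxes the selection constraint to the shut-down antennas, and ranks the
antennas by the power `p`. -/
def powerBB {X : Type} (solve : Finset (Fin N) → Option X) (value : X → ℝ)
    (beam : X → Option (Beam N M)) (p : X → Fin N → ℝ) : Method N M (Finset (Fin N)) X where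
  solve := solve
  value := value
  beam := beam
  lbKey := Node.B
  ubKey := id
  mayBranch := branchLargest p
  mayExclude := excludeSmallest p

/-- The method whose programs fix the relaxed Boolean variables of the decided antennas. -/
def booleanBB {X : Type} (solve : Node N → Option X) (value : X → ℝ)
    (beam : X → Option (Beam N M)) : Method N M (Node N) X where
  solve := solve
  value := value
  beam := beam
  lbKey := id
  ubKey := fun T => ⟨Tᶜ, T⟩
  mayBranch := fun _ _ _ => True
  mayExclude := fun _ _ _ => True

/-- Hockey-stick identity after the substitution i ↦ N - i; the two sides are in fact equal. -/
theorem choose_le_sum_choose (hL : 1 ≤ L) (hLN : L < N) :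
    (N - 1).choose L ≤ ∑ i ∈ Finset.Icc 2 (N - L + 1), (N - i).choose (L - 1) := by
  obtain ⟨l, rfl⟩ : ∃ l, L = l + 1 := ⟨L - 1, by omega⟩
  obtain ⟨n, rfl⟩ : ∃ n, N = n + 2 := ⟨N - 2, by omega⟩
  have h := Nat.sum_Icc_choose n l
  simp only [Nat.add_sub_cancel]
  rw [show n + 2 - 1 = n + 1 by omega, ← h]
  refine (Finset.sum_nbij' (fun i => n + 2 - i) (fun i => n + 2 - i) ?_ ?_ ?_ ?_ ?_).le
  all_goals intro i hi; simp only [Finset.mem_Icc] at hi ⊢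
  · omega
  · omega
  · omega
  · omega
  · congr 1; omega

/-- A non-leaf node has at least two completions, so the subtraction of 2 in the weight of
`countBound_booleanBB` is not truncated there. -/
theorem two_le_choose {n k : ℕ} (hk : 1 ≤ k) (hkn : k < n) : 2 ≤ n.choose k := by
  obtain ⟨k, rfl⟩ : ∃ j, k = j + 1 := ⟨k - 1, by omega⟩
  obtain ⟨n, rfl⟩ : ∃ j, n = j + 1 := ⟨n - 1, by omega⟩
  have h1 : 0 < n.choose k := Nat.choose_pos (by omega)
  have h2 : 0 < n.choose (k + 1) := Nat.choose_pos (by omega)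
  rw [Nat.choose_succ_succ, Nat.succ_eq_add_one]
  omega

theorem Node.eq_left_of_not_isLeaf {ν : Node N} (hv : ν.Valid L) (hl : ¬ ν.IsLeaf L) {n : Fin N}
    (hn : n ∈ ν.undecided) :
    (ν.left L n).B = insert n ν.B ∧
      ((ν.B.card + 1 = N - L ∧ ν.left L n = ⟨(insert n ν.B)ᶜ, insert n ν.B⟩) ∨
        (ν.B.card + 1 < N - L ∧ ν.left L n = ⟨ν.A, insert n ν.B⟩)) := by
  have h := hv.lt_of_not_isLeaf hl
  have hc := Finset.card_insert_of_notMem (Node.mem_undecided.1 hn).2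
  unfold Node.left
  by_cases h1 : ν.B.card + 1 = N - L
  · rw [Node.complete_of_card_B ⟨ν.A, insert n ν.B⟩ h.1.ne (hc.trans h1)]
    exact ⟨rfl, Or.inl ⟨h1, rfl⟩⟩
  · rw [Node.complete_of_lt ⟨ν.A, insert n ν.B⟩ h.1 (by simp only [hc]; omega)]
    exact ⟨rfl, Or.inr ⟨by omega, rfl⟩⟩

theorem Node.eq_right_of_not_isLeaf {ν : Node N} (hv : ν.Valid L) (hl : ¬ ν.IsLeaf L) {n : Fin N}
    (hn : n ∈ ν.undecided) :
    (ν.A.card + 1 = L ∧ ν.right L n = ⟨insert n ν.A, (insert n ν.A)ᶜ⟩) ∨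
      (ν.A.card + 1 < L ∧ ν.right L n = ⟨insert n ν.A, ν.B⟩) := by
  have h := hv.lt_of_not_isLeaf hl
  have hc := Finset.card_insert_of_notMem (Node.mem_undecided.1 hn).1
  unfold Node.right
  by_cases h1 : ν.A.card + 1 = L
  · rw [Node.complete_of_card_A ⟨insert n ν.A, ν.B⟩ (hc.trans h1)]
    exact Or.inl ⟨h1, rfl⟩
  · rw [Node.complete_of_lt ⟨insert n ν.A, ν.B⟩ (by simp only [hc]; omega) h.2]
    exact Or.inr ⟨by omega, rfl⟩

/-- Sizes of a child in terms of those of its parent. -/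
theorem Node.sizes_left {ν : Node N} (hv : ν.Valid L) (hl : ¬ ν.IsLeaf L) {n : Fin N}
    (hn : n ∈ ν.undecided) (h : ν.B.card + 1 < N - L) :
    (ν.left L n).undecided.card = ν.undecided.card - 1 ∧ (ν.left L n).A.card = ν.A.card := by
  have hn' := Node.mem_undecided.1 hn
  rcases (Node.eq_left_of_not_isLeaf hv hl hn).2 with h1 | ⟨-, h1⟩
  · omega
  · rw [h1]
    have hd : Disjoint ν.A (insert n ν.B) := Finset.disjoint_insert_right.2 ⟨hn'.1, hv.1⟩
    have h2 := Node.card_undecided (ν := ⟨ν.A, insert n ν.B⟩) hd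
    have h3 := Node.card_undecided hv.1
    simp only [Finset.card_insert_of_notMem hn'.2] at h2
    exact ⟨by omega, rfl⟩

theorem Node.sizes_right {ν : Node N} (hv : ν.Valid L) (hl : ¬ ν.IsLeaf L) {n : Fin N}
    (hn : n ∈ ν.undecided) (h : ν.A.card + 1 < L) :
    (ν.right L n).undecided.card = ν.undecided.card - 1 ∧
      (ν.right L n).A.card = ν.A.card + 1 := by
  have hn' := Node.mem_undecided.1 hn
  rcases Node.eq_right_of_not_isLeaf hv hl hn with h1 | ⟨-, h1⟩
  · omega
  · rw [h1]
    have hd : Disjoint (insert n ν.A) ν.B := Finset.disjoint_insert_left.2 ⟨hn'.2, hv.1⟩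
    have h2 := Node.card_undecided (ν := ⟨insert n ν.A, ν.B⟩) hd
    have h3 := Node.card_undecided hv.1
    have h4 := Finset.card_insert_of_notMem hn'.1
    simp only [h4] at h2
    exact ⟨by omega, h4⟩

theorem Node.sizes_left_leaf {ν : Node N} (hLN : L ≤ N) (hv : ν.Valid L) (hl : ¬ ν.IsLeaf L)
    {n : Fin N} (hn : n ∈ ν.undecided) (h : ν.B.card + 1 = N - L) :
    (ν.left L n).undecided.card = 0 ∧ (ν.left L n).A.card = L ∧
      (ν.left L n).B.card = N - L ∧ (ν.left L n).A = (ν.left L n).Bᶜ := by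
  have hn' := Node.mem_undecided.1 hn
  rcases (Node.eq_left_of_not_isLeaf hv hl hn).2 with ⟨-, h1⟩ | h1
  · rw [h1]
    simp only [Finset.card_compl, Fintype.card_fin, Finset.card_insert_of_notMem hn'.2, and_true]
    exact ⟨by simp only [Node.undecided, Finset.union_comm, Finset.union_compl, Finset.compl_univ,
      Finset.card_empty], by omega, by omega⟩
  · omega

theorem Node.sizes_right_leaf {ν : Node N} (hv : ν.Valid L) (hl : ¬ ν.IsLeaf L)
    {n : Fin N} (hn : n ∈ ν.undecided) (h : ν.A.card + 1 = L) :
    (ν.right L n).undecided.card = 0 ∧ (ν.right L n).A.card = L ∧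
      (ν.right L n).B.card = N - L ∧ (ν.right L n).A = (ν.right L n).Bᶜ := by
  have hn' := Node.mem_undecided.1 hn
  rcases Node.eq_right_of_not_isLeaf hv hl hn with ⟨-, h1⟩ | h1
  · rw [h1]
    simp only [Finset.card_compl, Fintype.card_fin, Finset.card_insert_of_notMem hn'.1, compl_compl,
      and_true]
    exact ⟨by simp only [Node.undecided, Finset.union_compl, Finset.compl_univ,
      Finset.card_empty], by omega, by omega⟩
  · omega

theorem Node.root_eq (hL : 1 ≤ L) (hLN : L < N) : Node.root N L = ⟨∅, ∅⟩ :=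
  Node.complete_of_lt _ (by simp; omega) (by simp; omega)

theorem Node.root_eq_of_eq (hL : 1 ≤ N) : Node.root N N = ⟨Finset.univ, ∅⟩ := by
  rw [Node.root, Node.complete_of_card_B _ (by simp; omega) (by simp)]
  simp

/-- The weight solves the recursion g = 1 + g(left) + g(right) for non-leaf left children: with the
two undecided counts reduced by one, this is Pascal's rule. At leaves it is C(0, 0) - 1 = 0, where
the predecessor of 0 is 0. -/
theorem countBound_powerBB {X : Type} (solve : Finset (Fin N) → Option X) (value : X → ℝ)
    (beam : X → Option (Beam N M)) (p : X → Fin N → ℝ) (hLN : L ≤ N) :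
    (powerBB solve value beam p).CountBound L (Finset.powersetCard (N - L) Finset.univ)
      (fun ν => (ν.undecided.card - 1).choose (L - ν.A.card) - 1) := by
  refine ⟨fun T hT => by simpa [powerBB] using hT, fun ν hv hl n hn => ?_⟩
  have hlt := hv.lt_of_not_isLeaf hl
  have hc := Node.card_undecided hv.1
  set K : Finset (Finset (Fin N)) := Finset.powersetCard (N - L) Finset.univ with hK
  have hmem : ∀ T : Finset (Fin N), T.card = N - L → T ∈ K := by simp [hK]
  change (({(ν.left L n).B, (ν.right L n).B} : Finset (Finset (Fin N))) \ insert ν.B K).card +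
    _ + _ ≤ _
  obtain ⟨u, hu⟩ : ∃ u, ν.undecided.card = u + 2 := ⟨ν.undecided.card - 2, by omega⟩
  obtain ⟨l, hl'⟩ : ∃ l, L - ν.A.card = l + 1 := ⟨L - ν.A.card - 1, by omega⟩
  have hpas : (u + 1).choose (l + 1) = u.choose l + u.choose (l + 1) := Nat.choose_succ_succ u l
  -- The activating child never needs a new program outside K: it keeps B, or it is a leaf.
  have hright : (ν.right L n).B ∈ insert ν.B K := by
    rcases Node.eq_right_of_not_isLeaf hv hl hn with ⟨h1, -⟩ | ⟨-, h2⟩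
    · exact Finset.mem_insert_of_mem (hmem _ (Node.sizes_right_leaf hv hl hn h1).2.2.1)
    · rw [h2]; exact Finset.mem_insert_self _ _
  have hcard1 : (({(ν.left L n).B, (ν.right L n).B} : Finset (Finset (Fin N))) \
      insert ν.B K).card ≤ 1 := by
    rw [Finset.card_le_one]
    intro a ha b hb
    simp only [Finset.mem_sdiff, Finset.mem_insert, Finset.mem_singleton] at ha hb hright
    grind
  have hcard0 : ν.B.card + 1 = N - L →
      (({(ν.left L n).B, (ν.right L n).B} : Finset (Finset (Fin N))) \ insert ν.B K).card = 0 := by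
    intro h
    rw [Finset.card_eq_zero, Finset.sdiff_eq_empty_iff_subset]
    refine Finset.insert_subset (Finset.mem_insert_of_mem (hmem _ ?_)) (by simpa using hright)
    exact (Node.sizes_left_leaf hLN hv hl hn h).2.2.1
  rw [hu, hl', show u + 2 - 1 = u + 1 by omega, hpas]
  have hpos : 0 < u.choose l := Nat.choose_pos (by omega)
  have hposl : ν.B.card + 1 < N - L → 0 < u.choose (l + 1) := fun h => Nat.choose_pos (by omega)
  have hleft : (ν.B.card + 1 = N - L ∧ ((ν.left L n).undecided.card - 1).choose
      (L - (ν.left L n).A.card) - 1 = 0) ∨ (ν.B.card + 1 < N - L ∧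
      ((ν.left L n).undecided.card - 1).choose (L - (ν.left L n).A.card) = u.choose (l + 1)) := by
    by_cases h : ν.B.card + 1 = N - L
    · obtain ⟨h1, h2, -⟩ := Node.sizes_left_leaf hLN hv hl hn h
      exact Or.inl ⟨h, by simp [h1, h2]⟩
    · obtain ⟨h1, h2⟩ := Node.sizes_left hv hl hn (by omega)
      exact Or.inr ⟨by omega, by rw [h1, h2, hu, hl']; rfl⟩
  have hrt : ((ν.right L n).undecided.card - 1).choose (L - (ν.right L n).A.card) - 1 ≤
      u.choose l - 1 := by
    by_cases h : ν.A.card + 1 = L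
    · obtain ⟨h1, h2, -⟩ := Node.sizes_right_leaf hv hl hn h
      simp [h1, h2]
    · obtain ⟨h1, h2⟩ := Node.sizes_right hv hl hn (by omega)
      rw [h1, h2, hu, show L - (ν.A.card + 1) = l by omega]
      rfl
  rcases hleft with ⟨h, h1⟩ | ⟨h, h1⟩
  · rw [hcard0 h, h1]; omega
  · have := hposl h; rw [h1]; omega

theorem solvesAtMost_powerBB {X : Type} (solve : Finset (Fin N) → Option X) (value : X → ℝ)
    (beam : X → Option (Beam N M)) (p : X → Fin N → ℝ) (hL : 1 ≤ L) (hLN : L ≤ N) (tol : ℝ≥0) :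
    (powerBB solve value beam p).SolvesAtMost L tol
      (N.choose L + ∑ i ∈ Finset.Icc 2 (N - L + 1), (N - i).choose (L - 1)) := by
  refine (countBound_powerBB solve value beam p hLN).solvesAtMost hLN tol
    (Method.exists_excludes _ fun x => (Node.valid_root hLN).exists_exclude p x) ?_
  rw [Finset.card_powersetCard, Finset.card_univ, Fintype.card_fin, Nat.choose_symm hLN]
  refine Nat.add_le_add_left ?_ _
  change (({(Node.root N L).B} : Finset (Finset (Fin N))) \ _).card + _ ≤ _
  rcases hLN.lt_or_eq with h | rfl
  -- The root's own program, together with the weight C(N-1, L) - 1, accounts for C(N-1, L) programs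
  -- outside K.
  · refine le_trans ?_ (choose_le_sum_choose hL h)
    have h1 : 0 < (N - 1).choose L := Nat.choose_pos (by omega)
    have h2 := Finset.card_le_card (Finset.sdiff_subset
      (s := ({(Node.root N L).B} : Finset (Finset (Fin N))))
      (t := Finset.powersetCard (N - L) Finset.univ))
    rw [Finset.card_singleton] at h2
    have h3 : (Node.root N L).undecided.card = N ∧ (Node.root N L).A.card = 0 := by
      simp [Node.root_eq hL h, Node.undecided]
    rw [h3.1, h3.2, Nat.sub_zero]
    omega
  · rw [Node.root_eq_of_eq hL]
    simp [Node.undecided]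

/-- C(|undecided|, L - |A|) counts the leaves below a node. A binary tree has one internal node less
than leaves, and one more is subtracted because the node itself is already solved. -/
theorem countBound_booleanBB {X : Type} (solve : Node N → Option X) (value : X → ℝ)
    (beam : X → Option (Beam N M)) (hLN : L ≤ N) :
    (booleanBB solve value beam).CountBound L
      ((Finset.powersetCard (N - L) Finset.univ).image fun T => (⟨Tᶜ, T⟩ : Node N))
      (fun ν => ν.undecided.card.choose (L - ν.A.card) - 2) := by
  refine ⟨fun T hT => ?_, fun ν hv hl n hn => ?_⟩
  · exact Finset.mem_image_of_mem _ (by simpa using hT)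
  have hlt := hv.lt_of_not_isLeaf hl
  have hc := Node.card_undecided hv.1
  set K : Finset (Node N) :=
    (Finset.powersetCard (N - L) Finset.univ).image fun T => (⟨Tᶜ, T⟩ : Node N) with hK
  have hmem : ∀ ν : Node N, ν.B.card = N - L → ν.A = ν.Bᶜ → ν ∈ K := fun ν h h' =>
    Finset.mem_image.2 ⟨ν.B, by simpa using h, by rw [← h']⟩
  change (({ν.left L n, ν.right L n} : Finset (Node N)) \ insert ν K).card + _ + _ ≤ _
  obtain ⟨u, hu⟩ : ∃ u, ν.undecided.card = u + 1 := ⟨ν.undecided.card - 1, by omega⟩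
  obtain ⟨l, hl'⟩ : ∃ l, L - ν.A.card = l + 1 := ⟨L - ν.A.card - 1, by omega⟩
  have hsub : (({ν.left L n, ν.right L n} : Finset (Node N)) \ insert ν K).card ≤
      (({ν.left L n} : Finset (Node N)) \ K).card +
        (({ν.right L n} : Finset (Node N)) \ K).card := by
    refine (Finset.card_le_card fun k hk => ?_).trans (Finset.card_union_le _ _)
    simp only [Finset.mem_sdiff, Finset.mem_insert, Finset.mem_singleton, Finset.mem_union] at hk ⊢
    tauto
  have hle : (({ν.left L n} : Finset (Node N)) \ K).card +
      ((ν.left L n).undecided.card.choose (L - (ν.left L n).A.card) - 2) ≤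
      u.choose (l + 1) - 1 := by
    by_cases h : ν.B.card + 1 = N - L
    · obtain ⟨h1, h2, h3, h4⟩ := Node.sizes_left_leaf hLN hv hl hn h
      rw [Finset.sdiff_eq_empty_iff_subset.2 (by simpa using hmem _ h3 h4)]
      simp [h1, h2]
    · obtain ⟨h1, h2⟩ := Node.sizes_left hv hl hn (by omega)
      have h3 := Finset.card_le_card (Finset.sdiff_subset
        (s := ({ν.left L n} : Finset (Node N))) (t := K))
      rw [Finset.card_singleton] at h3
      rw [h1, h2, hu, hl', show u + 1 - 1 = u by omega]
      have h4 : 2 ≤ u.choose (l + 1) := two_le_choose (by omega) (by omega)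
      omega
  have hri : (({ν.right L n} : Finset (Node N)) \ K).card +
      ((ν.right L n).undecided.card.choose (L - (ν.right L n).A.card) - 2) ≤
      u.choose l - 1 := by
    by_cases h : ν.A.card + 1 = L
    · obtain ⟨h1, h2, h3, h4⟩ := Node.sizes_right_leaf hv hl hn h
      rw [Finset.sdiff_eq_empty_iff_subset.2 (by simpa using hmem _ h3 h4)]
      simp [h1, h2]
    · obtain ⟨h1, h2⟩ := Node.sizes_right hv hl hn (by omega)
      have h3 := Finset.card_le_card (Finset.sdiff_subset
        (s := ({ν.right L n} : Finset (Node N))) (t := K))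
      rw [Finset.card_singleton] at h3
      rw [h1, h2, hu, show L - (ν.A.card + 1) = l by omega, show u + 1 - 1 = u by omega]
      have h4 : 2 ≤ u.choose l := two_le_choose (by omega) (by omega)
      omega
  rw [hu, hl', Nat.choose_succ_succ]
  have h1 : 0 < u.choose l := Nat.choose_pos (by omega)
  have h2 : 0 < u.choose (l + 1) := Nat.choose_pos (by omega)
  rw [Nat.succ_eq_add_one]
  omega

theorem solvesAtMost_booleanBB {X : Type} (solve : Node N → Option X) (value : X → ℝ)
    (beam : X → Option (Beam N M)) (hL : 1 ≤ L) (hLN : L ≤ N) (tol : ℝ≥0) :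
    (booleanBB solve value beam).SolvesAtMost L tol (2 * N.choose L - 1) := by
  refine (countBound_booleanBB solve value beam hLN).solvesAtMost hLN tol
    (Method.exists_excludes _ fun x => ?_) ?_
  · obtain ⟨T, h1, h2, h3, -⟩ :=
      (Node.valid_root hLN).exists_exclude (fun (_ : Unit) (_ : Fin N) => (0 : ℝ)) ()
    exact ⟨T, h1, h2, h3, trivial⟩
  have hK := Finset.card_image_le (s := Finset.powersetCard (N - L) (Finset.univ : Finset (Fin N)))
    (f := fun T => (⟨Tᶜ, T⟩ : Node N))
  rw [Finset.card_powersetCard, Finset.card_univ, Fintype.card_fin, Nat.choose_symm hLN] at hK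
  change _ + ((({Node.root N L} : Finset (Node N)) \ _).card + _) ≤ _
  have hpos : 0 < N.choose L := Nat.choose_pos hLN
  rcases hLN.lt_or_eq with h | rfl
  · have h1 : 2 ≤ N.choose L := two_le_choose hL h
    have h2 := Finset.card_le_card (Finset.sdiff_subset
      (s := ({Node.root N L} : Finset (Node N)))
      (t := (Finset.powersetCard (N - L) Finset.univ).image fun T => (⟨Tᶜ, T⟩ : Node N)))
    rw [Finset.card_singleton] at h2
    have h3 : (Node.root N L).undecided.card = N ∧ (Node.root N L).A.card = 0 := by
      simp [Node.root_eq hL h, Node.undecided]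
    rw [h3.1, h3.2, Nat.sub_zero]
    omega
  · rw [Node.root_eq_of_eq hL]
    simp [Node.undecided]

/-! ### Global optimality -/

theorem relGap_self (u : ℝ≥0∞) : relGap u u = 0 := by simp [relGap]

/-- The degenerate quotients agree with the claim: for l = 0 < u the gap is +∞ and hence not within
tolerance, and for l = +∞ the right side is +∞. -/
theorem le_mul_of_relGap_le {u l : ℝ≥0∞} {tol : ℝ≥0} (h : relGap u l ≤ tol) (hlu : l ≤ u) :
    u ≤ (1 + tol) * l := by
  unfold relGap at h
  rw [tsub_eq_zero_of_le hlu, add_zero] at h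
  rcases eq_or_ne l ⊤ with rfl | hl
  · have : (1 + (tol : ℝ≥0∞)) * ⊤ = ⊤ := ENNReal.mul_top (by simp)
    rw [this]; exact le_top
  rcases eq_or_ne l 0 with rfl | hl0
  · rcases eq_or_ne u 0 with rfl | hu
    · simp
    · simp [ENNReal.div_zero hu] at h
  · rw [ENNReal.div_le_iff hl0 hl, tsub_le_iff_right] at h
    calc u ≤ tol * l + l := h
      _ = (1 + tol) * l := by ring

/-- Optimal value of the program that shuts down `T`, as reported by the solver. -/
noncomputable def solvedValue {X : Type} (solve : Finset (Fin N) → Option X) (value : X → ℝ)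
    (T : Finset (Fin N)) : ℝ≥0∞ :=
  match solve T with
  | some x => ENNReal.ofReal (value x)
  | none => ⊤

/-- What optimality of the search needs: the programs that leave `L` antennas have solutions that
can be realized by feasible beamformers, shutting down more antennas costs more, and the programs
that leave `L` antennas are together a relaxation of the problem. -/
structure ExactOnLeaves {X : Type} (solve : Finset (Fin N) → Option X) (value : X → ℝ)
    (beam : X → Option (Beam N M)) (L : ℕ) (feas : Set (Beam N M)) : Prop where
  exists_beam : ∀ T x, T.card = N - L → solve T = some x →
    ∃ W, beam x = some W ∧ W ∈ feas ∧ power W = value x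
  mono : ∀ B T, B ⊆ T → solvedValue solve value B ≤ solvedValue solve value T
  relax : ∀ W ∈ feas, ∃ T : Finset (Fin N), T.card = N - L ∧
    solvedValue solve value T ≤ ENNReal.ofReal (power W)

section

variable {X : Type} {solve : Finset (Fin N) → Option X} {value : X → ℝ}
  {beam : X → Option (Beam N M)} {p : X → Fin N → ℝ} {feas : Set (Beam N M)}

theorem lb_powerBB (ν : Node N) :
    (powerBB solve value beam p).lb ν = solvedValue solve value ν.B := rfl

theorem ExactOnLeaves.cost_ubBeam_eq (h : ExactOnLeaves solve value beam L feas) {ν : Node N}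
    {o : Option (Finset (Fin N))} (ho : (powerBB solve value beam p).Excludes L ν o) :
    cost ((powerBB solve value beam p).ubBeam o) = ⊤ ∨
      ∃ T : Finset (Fin N), T.card = N - L ∧
        solvedValue solve value T = cost ((powerBB solve value beam p).ubBeam o) := by
  cases o with
  | none => exact Or.inl rfl
  | some T =>
    have hT : T.card = N - L := ho.2.2.1
    cases hs : solve T with
    | none => exact Or.inl (by simp [Method.ubBeam, powerBB, hs, cost])
    | some x =>
      obtain ⟨W, hW, -, hv⟩ := h.exists_beam T x hT hs
      exact Or.inr ⟨T, hT, by simp [Method.ubBeam, powerBB, hs, hW, cost, solvedValue, hv]⟩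

theorem ExactOnLeaves.ubBeam_mem (h : ExactOnLeaves solve value beam L feas) {ν : Node N}
    {o : Option (Finset (Fin N))} (ho : (powerBB solve value beam p).Excludes L ν o)
    {W : Beam N M} (hW : (powerBB solve value beam p).ubBeam o = some W) : W ∈ feas := by
  cases o with
  | none => simp [Method.ubBeam] at hW
  | some T =>
    have hT : T.card = N - L := ho.2.2.1
    cases hs : solve T with
    | none => simp [Method.ubBeam, powerBB, hs] at hW
    | some x =>
      obtain ⟨W', hW', hmem, -⟩ := h.exists_beam T x hT hs
      simp only [Method.ubBeam, powerBB, hs, Option.bind_some, id, hW', Option.some.injEq] at hW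
      rwa [← hW]

/-- A leaf leaves no choice for the set shut down, so both bounds come from the same program, whose
solution is realizable. -/
theorem ExactOnLeaves.cost_ubBeam_le_lb (h : ExactOnLeaves solve value beam L feas) {ν : Node N}
    (hl : ν.IsLeaf L) {o : Option (Finset (Fin N))}
    (ho : (powerBB solve value beam p).Excludes L ν o) :
    cost ((powerBB solve value beam p).ubBeam o) ≤ (powerBB solve value beam p).lb ν := by
  rw [lb_powerBB]
  cases o with
  | none =>
    have : solve ν.B = none := ho
    simp [solvedValue, this]
  | some T =>
    have hT : ν.B = T := Finset.eq_of_subset_of_card_le ho.1 (by rw [ho.2.2.1, hl.2])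
    subst hT
    cases hs : solve ν.B with
    | none => simp [solvedValue, hs]
    | some x =>
      obtain ⟨W, hW, -, hv⟩ := h.exists_beam _ x hl.2 hs
      simp [Method.ubBeam, powerBB, hs, hW, cost, solvedValue, hv]

/-- `cover` says that pruning is safe. Its strict inequality, combined with `attained`, shows that a
T with value equal to the upper bound has not been discarded, which gives lower ≤ upper. `leaf` and
`lower_attained` ensure that an unfinished run can continue. The latter is conditional because the
minimum is taken before pruning. -/
structure SearchInvariant (solve : Finset (Fin N) → Option X) (value : X → ℝ)
    (L : ℕ) (feas : Set (Beam N M)) (s : State N M (Finset (Fin N))) : Prop where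
  valid : ∀ ν ∈ s.frontier, ν.Valid L
  upper_eq : s.upper = cost s.incumbent
  mem_feas : ∀ W, s.incumbent = some W → W ∈ feas
  cover : ∀ T : Finset (Fin N), T.card = N - L →
    (∃ ν ∈ s.frontier, ν.Compatible T) ∨ s.upper < solvedValue solve value T
  attained : s.upper = ⊤ ∨ ∃ T : Finset (Fin N), T.card = N - L ∧
    solvedValue solve value T = s.upper
  lower_le : ∀ ν ∈ s.frontier, s.lower ≤ solvedValue solve value ν.B
  leaf : ∀ ν ∈ s.frontier, ν.IsLeaf L → s.upper ≤ solvedValue solve value ν.B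
  lower_attained : s.lower ≤ s.upper →
    ∃ ν ∈ s.frontier, solvedValue solve value ν.B = s.lower

theorem ExactOnLeaves.invariant_of_initial (h : ExactOnLeaves solve value beam L feas)
    (hLN : L ≤ N) {s : State N M (Finset (Fin N))}
    (hs : (powerBB solve value beam p).Initial L s) :
    SearchInvariant solve value L feas s := by
  obtain ⟨o, ho, rfl⟩ := hs
  refine ⟨?_, rfl, fun W hW => h.ubBeam_mem ho hW, ?_, h.cost_ubBeam_eq ho, ?_, ?_, ?_⟩
  · simpa using Node.valid_root hLN
  · exact fun T hT => Or.inl ⟨_, Finset.mem_singleton_self _, Node.compatible_root hLN hT⟩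
  · simp [lb_powerBB]
  · intro ν hν hl
    rw [Finset.mem_singleton] at hν
    subst hν
    exact h.cost_ubBeam_le_lb hl ho
  · exact fun _ => ⟨_, Finset.mem_singleton_self _, rfl⟩

theorem SearchInvariant.lower_le_upper (h : ExactOnLeaves solve value beam L feas)
    {s : State N M (Finset (Fin N))}
    (hs : SearchInvariant solve value L feas s) : s.lower ≤ s.upper := by
  rcases hs.attained with h1 | ⟨T, hT, h1⟩
  · simp [h1]
  · rcases hs.cover T hT with ⟨ν, hν, hc⟩ | h2
    · exact ((hs.lower_le ν hν).trans (h.mono _ _ hc.1)).trans h1.le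
    · exact absurd h2 (by simp [h1])

theorem SearchInvariant.lower_le_solvedValue (h : ExactOnLeaves solve value beam L feas)
    {s : State N M (Finset (Fin N))}
    (hs : SearchInvariant solve value L feas s) {T : Finset (Fin N)} (hT : T.card = N - L) :
    s.lower ≤ solvedValue solve value T := by
  rcases hs.cover T hT with ⟨ν, hν, hc⟩ | h2
  · exact (hs.lower_le ν hν).trans (h.mono _ _ hc.1)
  · exact (hs.lower_le_upper h).trans h2.le

theorem SearchInvariant.step (h : ExactOnLeaves solve value beam L feas) (hLN : L ≤ N)
    {tol : ℝ≥0} {s s' : State N M (Finset (Fin N))} (hs : SearchInvariant solve value L feas s)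
    (hstep : (powerBB solve value beam p).Step L tol s s') :
    SearchInvariant solve value L feas s' := by
  obtain ⟨-, ν, hν, hl, -, x, -, n, hn, -, o₁, o₂, ho₁, ho₂, W, hW, hW₁, hW₂, rfl⟩ := hstep
  set E := powerBB solve value beam p with hE
  set c := E.evaluate (E.evaluate (s.cache, s.calls) (ν.left L n) o₁) (ν.right L n) o₂
  have hv := hs.valid ν hν
  set F : Finset (Node N) :=
    insert (ν.left L n) (insert (ν.right L n) (s.frontier.erase ν)) with hF
  set u : ℝ≥0∞ := if cost W ≤ s.upper then cost W else s.upper with hu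
  have huW : u ≤ cost W := by
    rw [hu]; split_ifs with h1
    · exact le_rfl
    · exact (not_le.1 h1).le
  have hus : u ≤ s.upper := by
    rw [hu]; split_ifs with h1
    · exact h1
    · exact le_rfl
  have hfr : ∀ ν', ν' ∈ (E.next s ν (ν.left L n) (ν.right L n) W c).frontier ↔
      ν' ∈ F ∧ solvedValue solve value ν'.B ≤ u := fun ν' => Finset.mem_filter
  have hmemF : ∀ ν', ν' ∈ F ↔ ν' = ν.left L n ∨ ν' = ν.right L n ∨ (ν' ≠ ν ∧ ν' ∈ s.frontier) := by
    intro ν'; simp [hF]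
  refine ⟨?_, ?_, ?_, ?_, ?_, ?_, ?_, ?_⟩
  · intro ν' h'
    rcases (hmemF ν').1 ((hfr ν').1 h').1 with rfl | rfl | h'
    · exact hv.left hLN hl hn
    · exact hv.right hLN hl hn
    · exact hs.valid _ h'.2
  · change (if cost W ≤ s.upper then cost W else s.upper) =
      cost (if cost W ≤ s.upper then W else s.incumbent)
    split_ifs
    · rfl
    · exact hs.upper_eq
  · intro W' hW'
    change (if cost W ≤ s.upper then W else s.incumbent) = some W' at hW'
    split_ifs at hW'
    · rcases hW with rfl | rfl
      · exact h.ubBeam_mem ho₁ hW'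
      · exact h.ubBeam_mem ho₂ hW'
    · exact hs.mem_feas _ hW'
  · intro T hT
    change _ ∨ u < _
    rcases hs.cover T hT with ⟨ν', hν', hc⟩ | h1
    · obtain ⟨ν'', h1, h2⟩ : ∃ ν'' ∈ F, ν''.Compatible T := by
        by_cases hνν : ν' = ν
        · subst hνν
          rcases hc.left_or_right hLN hT n with h1 | h1
          · exact ⟨_, (hmemF _).2 (Or.inl rfl), h1⟩
          · exact ⟨_, (hmemF _).2 (Or.inr (Or.inl rfl)), h1⟩
        · exact ⟨ν', (hmemF _).2 (Or.inr (Or.inr ⟨hνν, hν'⟩)), hc⟩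
      by_cases h3 : solvedValue solve value ν''.B ≤ u
      · exact Or.inl ⟨ν'', (hfr _).2 ⟨h1, h3⟩, h2⟩
      -- A pruned node has value above u, and by monotonicity so has every T compatible with it.
      · exact Or.inr ((not_le.1 h3).trans_le (h.mono _ _ h2.1))
    · exact Or.inr (hus.trans_lt h1)
  · change u = ⊤ ∨ ∃ T : Finset (Fin N), T.card = N - L ∧ solvedValue solve value T = u
    rw [hu]
    split_ifs
    · rcases hW with rfl | rfl
      · exact h.cost_ubBeam_eq ho₁
      · exact h.cost_ubBeam_eq ho₂
    · exact hs.attained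
  · intro ν' h'
    exact Finset.inf_le (f := E.lb) ((hfr ν').1 h').1
  · intro ν' h' hl'
    change u ≤ _
    rcases (hmemF ν').1 ((hfr ν').1 h').1 with rfl | rfl | h'
    · exact (huW.trans hW₁).trans (h.cost_ubBeam_le_lb hl' ho₁)
    · exact (huW.trans hW₂).trans (h.cost_ubBeam_le_lb hl' ho₂)
    · exact hus.trans (hs.leaf _ h'.2 hl')
  · intro hlow
    change F.inf E.lb ≤ u at hlow
    obtain ⟨ν', h1, h2⟩ := Finset.exists_min_image F E.lb ⟨_, Finset.mem_insert_self _ _⟩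
    have h3 : E.lb ν' = F.inf E.lb := le_antisymm (Finset.le_inf h2) (Finset.inf_le h1)
    exact ⟨ν', (hfr _).2 ⟨h1, h3.le.trans hlow⟩, h3⟩

theorem ExactOnLeaves.invariant_of_reachable (h : ExactOnLeaves solve value beam L feas)
    (hLN : L ≤ N) {tol : ℝ≥0} {s : State N M (Finset (Fin N))}
    (hs : (powerBB solve value beam p).Reachable L tol s) :
    SearchInvariant solve value L feas s := by
  obtain ⟨s₀, h0, hr⟩ := hs
  induction hr with
  | refl => exact h.invariant_of_initial hLN h0
  | tail _ hstep ih => exact ih.step h hLN hstep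

/-- A positive gap puts the node that attains the lower bound strictly below the upper bound. It is
then neither a leaf nor infeasible, and it is lowest among all unbranched nodes. -/
theorem SearchInvariant.exists_step (h : ExactOnLeaves solve value beam L feas) (hLN : L ≤ N)
    {tol : ℝ≥0} {s : State N M (Finset (Fin N))} (hs : SearchInvariant solve value L feas s)
    (hh : ¬ Method.Halted tol s) : ∃ s', (powerBB solve value beam p).Step L tol s s' := by
  set E := powerBB solve value beam p with hE
  have hlt : s.lower < s.upper := by
    refine lt_of_le_of_ne (hs.lower_le_upper h) fun he => hh (Or.inr ?_)
    rw [he, relGap_self]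
    exact zero_le
  obtain ⟨ν, hν, hlb⟩ := hs.lower_attained hlt.le
  have hl : ¬ ν.IsLeaf L := fun hl => absurd (hs.leaf ν hν hl) (by rw [hlb]; exact not_le.2 hlt)
  have hv := hs.valid ν hν
  obtain ⟨x, hx⟩ : ∃ x, solve ν.B = some x := by
    cases hsol : solve ν.B with
    | none =>
      rw [solvedValue, hsol] at hlb
      exact absurd hlt (by simp [← hlb])
    | some x => exact ⟨x, rfl⟩
  have hne : ν.undecided.Nonempty := by
    have h1 := hv.lt_of_not_isLeaf hl
    have h2 := Node.card_undecided hv.1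
    rw [← Finset.card_pos]
    omega
  obtain ⟨n, hn, hmax⟩ := Finset.exists_max_image ν.undecided (p x) hne
  obtain ⟨o₁, ho₁⟩ := E.exists_excludes (L := L) (ν := ν.left L n)
    fun x => (hv.left hLN hl hn).exists_exclude p x
  obtain ⟨o₂, ho₂⟩ := E.exists_excludes (L := L) (ν := ν.right L n)
    fun x => (hv.right hLN hl hn).exists_exclude p x
  obtain ⟨W, hW, h1, h2⟩ : ∃ W, (W = E.ubBeam o₁ ∨ W = E.ubBeam o₂) ∧
      cost W ≤ cost (E.ubBeam o₁) ∧ cost W ≤ cost (E.ubBeam o₂) := by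
    rcases le_total (cost (E.ubBeam o₁)) (cost (E.ubBeam o₂)) with h1 | h1
    · exact ⟨_, Or.inl rfl, le_rfl, h1⟩
    · exact ⟨_, Or.inr rfl, h1, le_rfl⟩
  exact ⟨_, hh, ν, hν, hl, fun ν' hν' _ => hlb.le.trans (hs.lower_le ν' hν'), x, hx, n, hn, hmax,
    o₁, o₂, ho₁, ho₂, W, hW, h1, h2, rfl⟩

theorem ExactOnLeaves.solvesOptimally (h : ExactOnLeaves solve value beam L feas) (hLN : L ≤ N)
    (tol : ℝ≥0) : (powerBB solve value beam p).SolvesOptimally L tol feas := by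
  refine ⟨Method.terminates tol (Method.exists_excludes _ fun x =>
    (Node.valid_root hLN).exists_exclude p x), fun s hs hh =>
    (h.invariant_of_reachable hLN hs).exists_step h hLN hh, fun s hs hh => ?_⟩
  have hi := h.invariant_of_reachable hLN hs
  have hgap : s.upper ≤ (1 + tol) * s.lower := by
    -- An empty frontier cannot occur, since some unbranched node attains the lower bound; halting
    -- always means a small gap.
    rcases hh with hh | hh
    · obtain ⟨ν, hν, -⟩ := hi.lower_attained (hi.lower_le_upper h)
      simp [hh] at hν
    · exact le_mul_of_relGap_le hh (hi.lower_le_upper h)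
  have hbound : ∀ W' ∈ feas, s.upper ≤ (1 + tol) * ENNReal.ofReal (power W') := by
    intro W' hW'
    obtain ⟨T, hT, hle⟩ := h.relax W' hW'
    exact hgap.trans (mul_le_mul_right ((hi.lower_le_solvedValue h hT).trans hle) _)
  rw [hi.upper_eq] at hbound
  refine ⟨fun W hW => ⟨hi.mem_feas W hW, fun W' hW' => ?_⟩, fun hnone => ?_⟩
  · have h1 := hbound W' hW'
    have h2 : 0 ≤ power W' := Finset.sum_nonneg fun _ _ => Finset.sum_nonneg fun _ _ => by positivity
    have h3 : (1 + (tol : ℝ≥0∞)) = ENNReal.ofReal (1 + (tol : ℝ)) := by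
      rw [ENNReal.ofReal_add zero_le_one tol.coe_nonneg]; simp
    rw [hW, h3, ← ENNReal.ofReal_mul (by positivity)] at h1
    exact (ENNReal.ofReal_le_ofReal_iff (by positivity)).1 h1
  · refine Set.eq_empty_of_forall_notMem fun W' hW' => ?_
    have h1 := hbound W' hW'
    rw [hnone] at h1
    have : (1 + (tol : ℝ≥0∞)) * ENNReal.ofReal (power W') < ⊤ :=
      ENNReal.mul_lt_top (by simp) ENNReal.ofReal_lt_top
    exact absurd h1 (not_le.2 this)

end

/-! ### Quadratic forms -/

theorem normSq_dotProduct_le {ι : Type*} [Fintype ι] (u v : ι → ℂ) :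
    ‖star u ⬝ᵥ v‖ ^ 2 ≤ (∑ i, ‖u i‖ ^ 2) * ∑ i, ‖v i‖ ^ 2 := by
  refine le_trans ?_ (Finset.sum_mul_sq_le_sq_mul_sq Finset.univ (fun i => ‖u i‖) fun i => ‖v i‖)
  gcongr
  refine (norm_sum_le _ _).trans_eq (Finset.sum_congr rfl fun i _ => ?_)
  simp

theorem star_dotProduct_self {ι : Type*} [Fintype ι] (u : ι → ℂ) :
    star u ⬝ᵥ u = ((∑ i, ‖u i‖ ^ 2 : ℝ) : ℂ) := by
  simp only [dotProduct, Pi.star_apply, Complex.ofReal_sum]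
  refine Finset.sum_congr rfl fun i _ => ?_
  rw [RCLike.star_def, Complex.conj_mul']
  simp

theorem quad_add (S S' : Matrix (Fin N) (Fin N) ℂ) (h : Fin N → ℂ) :
    quad (S + S') h = quad S h + quad S' h := by
  simp [quad, Matrix.add_mulVec, dotProduct_add]

theorem quad_smul (c : ℝ) (S : Matrix (Fin N) (Fin N) ℂ) (h : Fin N → ℂ) :
    quad ((c : ℂ) • S) h = c * quad S h := by
  simp [quad, Matrix.smul_mulVec]

theorem quad_vecMulVec (a h : Fin N → ℂ) :
    quad (Matrix.vecMulVec a (star a)) h = ‖star a ⬝ᵥ h‖ ^ 2 := by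
  have h1 : star h ⬝ᵥ a = star (star a ⬝ᵥ h) := by
    rw [← Matrix.star_dotProduct_star, star_star]
  rw [quad, Matrix.vecMulVec_mulVec, op_smul_eq_smul, dotProduct_smul, smul_eq_mul, h1]
  rw [RCLike.star_def, Complex.mul_conj']
  norm_cast

theorem quad_conjTranspose_mul_self {ι : Type*} [Fintype ι] (B : Matrix ι (Fin N) ℂ)
    (h : Fin N → ℂ) : quad (Bᴴ * B) h = ∑ i, ‖(B *ᵥ h) i‖ ^ 2 := by
  have : star h ⬝ᵥ ((Bᴴ * B) *ᵥ h) = star (B *ᵥ h) ⬝ᵥ (B *ᵥ h) := by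
    rw [← Matrix.mulVec_mulVec, Matrix.dotProduct_mulVec, Matrix.star_mulVec]
  rw [quad, this, star_dotProduct_self, Complex.ofReal_re]

theorem quad_nonneg {S : Matrix (Fin N) (Fin N) ℂ} (hS : S.PosSemidef) (h : Fin N → ℂ) :
    0 ≤ quad S h := (Complex.le_def.1 (hS.dotProduct_mulVec_nonneg h)).1

theorem im_dotProduct_mulVec {S : Matrix (Fin N) (Fin N) ℂ} (hS : S.IsHermitian) (h : Fin N → ℂ) :
    (star h ⬝ᵥ (S *ᵥ h)).im = 0 := by
  have h1 : star (star h ⬝ᵥ (S *ᵥ h)) = star h ⬝ᵥ (S *ᵥ h) := by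
    rw [← Matrix.star_dotProduct_star, star_star, Matrix.star_mulVec, hS.eq,
      ← Matrix.dotProduct_mulVec]
  exact Complex.conj_eq_iff_im.1 h1

/-- `quad` keeps only the real part; hermitian symmetry makes the imaginary part vanish. -/
theorem posSemidef_iff_quad {S : Matrix (Fin N) (Fin N) ℂ} :
    S.PosSemidef ↔ S.IsHermitian ∧ ∀ h, 0 ≤ quad S h := by
  refine ⟨fun h => ⟨h.isHermitian, quad_nonneg h⟩, fun h =>
    Matrix.PosSemidef.of_dotProduct_mulVec_nonneg h.1 fun x => Complex.le_def.2 ⟨h.2 x, ?_⟩⟩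
  exact (im_dotProduct_mulVec h.1 x).symm

open scoped MatrixOrder in
theorem exists_eq_conjTranspose_mul_self {S : Matrix (Fin N) (Fin N) ℂ} (hS : S.PosSemidef) :
    ∃ B : Matrix (Fin N) (Fin N) ℂ, S = Bᴴ * B :=
  CStarAlgebra.nonneg_iff_eq_star_mul_self.mp hS.nonneg

theorem diag_conjTranspose_mul_self (B : Matrix (Fin N) (Fin N) ℂ) (j : Fin N) :
    ((Bᴴ * B) j j).re = ∑ i, ‖B i j‖ ^ 2 := by
  rw [Matrix.mul_apply]
  simp only [Matrix.conjTranspose_apply, RCLike.star_def, Complex.conj_mul']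
  norm_cast

theorem diag_re_nonneg {S : Matrix (Fin N) (Fin N) ℂ} (hS : S.PosSemidef) (j : Fin N) :
    0 ≤ (S j j).re := (Complex.le_def.1 hS.diag_nonneg).1

theorem diag_re_le_trace {S : Matrix (Fin N) (Fin N) ℂ} (hS : S.PosSemidef) (j : Fin N) :
    (S j j).re ≤ S.trace.re := by
  rw [Matrix.trace, Complex.re_sum]
  exact Finset.single_le_sum (f := fun i => (S i i).re) (fun i _ => diag_re_nonneg hS i)
    (Finset.mem_univ j)

theorem trace_re_nonneg {S : Matrix (Fin N) (Fin N) ℂ} (hS : S.PosSemidef) :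
    0 ≤ S.trace.re := (Complex.le_def.1 hS.trace_nonneg).1

/-- Factor S = BᴴB and use 2xy ≤ x² + y² termwise. It makes the sublevel sets of the relaxation
bounded. -/
theorem norm_entry_le_trace {S : Matrix (Fin N) (Fin N) ℂ} (hS : S.PosSemidef) (i j : Fin N) :
    ‖S i j‖ ≤ S.trace.re := by
  have hi := diag_re_le_trace hS i
  have hj := diag_re_le_trace hS j
  obtain ⟨B, rfl⟩ := exists_eq_conjTranspose_mul_self hS
  rw [diag_conjTranspose_mul_self] at hi hj
  have h1 : ‖(Bᴴ * B) i j‖ ≤ ∑ k, (‖B k i‖ ^ 2 + ‖B k j‖ ^ 2) / 2 := by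
    rw [Matrix.mul_apply]
    refine (norm_sum_le _ _).trans (Finset.sum_le_sum fun k _ => ?_)
    rw [norm_mul, Matrix.conjTranspose_apply, norm_star]
    nlinarith [sq_nonneg (‖B k i‖ - ‖B k j‖)]
  rw [← Finset.sum_div, Finset.sum_add_distrib] at h1
  linarith

theorem quad_le_trace_mul {S : Matrix (Fin N) (Fin N) ℂ} (hS : S.PosSemidef) (h : Fin N → ℂ) :
    quad S h ≤ S.trace.re * ∑ i, ‖h i‖ ^ 2 := by
  obtain ⟨B, rfl⟩ := exists_eq_conjTranspose_mul_self hS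
  rw [quad_conjTranspose_mul_self, Matrix.trace, Complex.re_sum]
  simp only [Matrix.diag_apply, diag_conjTranspose_mul_self]
  rw [Finset.sum_comm, Finset.sum_mul]
  refine Finset.sum_le_sum fun k _ => ?_
  have := normSq_dotProduct_le (star (B k)) h
  rw [star_star] at this
  simpa [Matrix.mulVec] using this

theorem trace_vecMulVec_re (a : Fin N → ℂ) :
    (Matrix.vecMulVec a (star a)).trace.re = ∑ i, ‖a i‖ ^ 2 := by
  rw [Matrix.trace_vecMulVec, dotProduct_comm, star_dotProduct_self, Complex.ofReal_re]

/-- Splits off the rank-one part of a positive semidefinite matrix that carries all of its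
action on `q`. -/
theorem exists_rankOne_add {S : Matrix (Fin N) (Fin N) ℂ} (hS : S.PosSemidef) (q : Fin N → ℂ) :
    ∃ (a : Fin N → ℂ) (D : Matrix (Fin N) (Fin N) ℂ), D.PosSemidef ∧ D *ᵥ q = 0 ∧
      S = Matrix.vecMulVec a (star a) + D := by
  by_cases hc : S *ᵥ q = 0
  · exact ⟨0, S, hS, hc, by simp⟩
  obtain ⟨B, hB⟩ := exists_eq_conjTranspose_mul_self hS
  have hSq : S *ᵥ q = Bᴴ *ᵥ (B *ᵥ q) := by rw [hB, Matrix.mulVec_mulVec]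
  set b := B *ᵥ q with hb
  set c : ℝ := ∑ i, ‖b i‖ ^ 2 with hcdef
  have hbb : star b ⬝ᵥ b = (c : ℂ) := star_dotProduct_self b
  have hcpos : 0 < c := by
    refine lt_of_le_of_ne (by positivity) fun h0 => hc ?_
    rw [hSq]
    have : b = 0 := by
      rw [← dotProduct_star_self_eq_zero, hbb, ← h0]; simp
    simp [this]
  -- Here c = qᴴSq, so a = Sq / √(qᴴSq); this scaling gives a(aᴴq) = Sq.
  set a : Fin N → ℂ := ((√c)⁻¹ : ℂ) • (S *ᵥ q) with ha
  have hss : ((√c : ℝ) : ℂ) * ((√c : ℝ) : ℂ) = c := by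
    rw [← Complex.ofReal_mul, Real.mul_self_sqrt hcpos.le]
  have hsne : ((√c : ℝ) : ℂ) ≠ 0 := by
    exact_mod_cast (Real.sqrt_pos.2 hcpos).ne'
  have hax : ∀ x, star a ⬝ᵥ x = ((√c)⁻¹ : ℂ) * (star b ⬝ᵥ (B *ᵥ x)) := by
    intro x
    rw [ha, hSq, star_smul, smul_dotProduct, Matrix.star_mulVec, Matrix.conjTranspose_conjTranspose,
      ← Matrix.dotProduct_mulVec]
    simp [Complex.conj_ofReal]
  refine ⟨a, S - Matrix.vecMulVec a (star a), ?_, ?_, by abel⟩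
  · rw [posSemidef_iff_quad]
    refine ⟨hS.isHermitian.sub (Matrix.posSemidef_vecMulVec_self_star a).isHermitian, fun x => ?_⟩
    have h1 : quad S x = quad (S - Matrix.vecMulVec a (star a)) x +
        quad (Matrix.vecMulVec a (star a)) x := by rw [← quad_add]; simp
    have h2 : quad (Matrix.vecMulVec a (star a)) x ≤ quad S x := by
      rw [quad_vecMulVec, hax, hB, quad_conjTranspose_mul_self, norm_mul, mul_pow, norm_inv,
        Complex.norm_real, Real.norm_of_nonneg (Real.sqrt_nonneg c), inv_pow, Real.sq_sqrt hcpos.le]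
      rw [inv_mul_le_iff₀ hcpos]
      -- Cauchy–Schwarz: |⟨Bq, Bx⟩|² ≤ ‖Bq‖² ‖Bx‖², which makes the remainder positive semidefinite.
      exact normSq_dotProduct_le b (B *ᵥ x)
    linarith
  · rw [Matrix.sub_mulVec, Matrix.vecMulVec_mulVec, hax, ← hb, hbb]
    rw [op_smul_eq_smul, ha, smul_smul, ← hss, mul_assoc, mul_assoc, mul_inv_cancel₀ hsne, mul_one,
      inv_mul_cancel₀ hsne, one_smul, sub_self]

/-! ### Existence of solvers -/

theorem exists_isSolver {κ X : Type} (p : κ → Program X)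
    (h : ∀ k, (p k).feasible.Nonempty →
      ∃ x ∈ (p k).feasible, ∀ y ∈ (p k).feasible, (p k).objective x ≤ (p k).objective y) :
    ∃ solve, IsSolver p solve := by
  classical
  refine ⟨fun k => if hk : (p k).feasible.Nonempty then some (h k hk).choose else none,
    fun k => ⟨fun x hx => ?_, fun hk => ?_⟩⟩
  · by_cases hk : (p k).feasible.Nonempty
    · simp only [hk, dif_pos, Option.some.injEq] at hx
      rw [← hx]
      exact (h k hk).choose_spec
    · simp [hk] at hx
  · by_contra hne
    simp [Set.nonempty_iff_ne_empty.2 hne] at hk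

/-- Coercivity: the sublevel set of any feasible point is compact and contains all competitors. -/
theorem exists_isMinimum {X : Type*} [TopologicalSpace X] {S : Set X} {f : X → ℝ}
    (hS : IsClosed S) (hf : Continuous f) (hK : ∀ r, ∃ K, IsCompact K ∧ ∀ x ∈ S, f x ≤ r → x ∈ K)
    (hne : S.Nonempty) : ∃ x ∈ S, ∀ y ∈ S, f x ≤ f y := by
  obtain ⟨x₀, hx₀⟩ := hne
  obtain ⟨K, hKc, hK⟩ := hK (f x₀)
  have hc : IsCompact (S ∩ {x | f x ≤ f x₀}) :=
    hKc.of_isClosed_subset (hS.inter (isClosed_le hf continuous_const)) fun x hx => hK x hx.1 hx.2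
  obtain ⟨x, hx, hmin⟩ := hc.exists_isMinOn ⟨x₀, hx₀, le_refl (f x₀)⟩ hf.continuousOn
  refine ⟨x, hx.1, fun y hy => ?_⟩
  rcases le_total (f y) (f x₀) with h | h
  · exact hmin ⟨hy, h⟩
  · exact hx.2.trans h

theorem isCompact_entries_le {ι κ : Type*} (r : ℝ) :
    IsCompact {W : Matrix ι κ ℂ | ∀ i j, ‖W i j‖ ≤ r} := by
  have h := isCompact_univ_pi (X := fun _ : ι => κ → ℂ) (s := fun _ => Set.univ.pi fun _ =>
    Metric.closedBall (0 : ℂ) r) fun _ => isCompact_univ_pi fun _ => isCompact_closedBall _ _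
  have he : {W : Matrix ι κ ℂ | ∀ i j, ‖W i j‖ ≤ r} =
      (Set.univ.pi fun _ : ι => Set.univ.pi fun _ : κ => Metric.closedBall (0 : ℂ) r) :=
    Set.ext fun W => by
      refine ⟨fun hW i _ j _ => mem_closedBall_zero_iff.2 (hW i j), fun hW i j =>
        mem_closedBall_zero_iff.1 (hW i trivial j trivial)⟩
  rw [he]
  exact h

theorem isCompact_lifted_entries_le (r : ℝ) :
    IsCompact {S : Lifted N M | ∀ m i j, ‖S m i j‖ ≤ r} := by
  have h := isCompact_univ_pi (X := fun _ : Fin M => Matrix (Fin N) (Fin N) ℂ)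
    (s := fun _ => {W : Matrix (Fin N) (Fin N) ℂ | ∀ i j, ‖W i j‖ ≤ r})
    fun _ => isCompact_entries_le r
  have he : {S : Lifted N M | ∀ m i j, ‖S m i j‖ ≤ r} =
      Set.univ.pi fun _ : Fin M => {W : Matrix (Fin N) (Fin N) ℂ | ∀ i j, ‖W i j‖ ≤ r} :=
    Set.ext fun S => by simp [Set.mem_pi]
  rw [he]
  exact h

theorem continuous_row {ι κ : Type*} (i : ι) : Continuous fun W : Matrix ι κ ℂ => W.row i :=
  continuous_pi fun j => continuous_id.matrix_elem i j

theorem continuous_power : Continuous (power : Beam N M → ℝ) := by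
  unfold power; fun_prop

theorem continuous_rowPower (n : Fin N) : Continuous fun W : Beam N M => rowPower W n := by
  unfold rowPower; fun_prop

theorem continuous_gain (j : Fin M) (h : Fin N → ℂ) :
    Continuous fun W : Beam N M => gain W j h := by
  simp only [gain, dotProduct, Pi.star_apply, Matrix.col_apply]; fun_prop

theorem continuous_quad (h : Fin N → ℂ) : Continuous fun S => quad S h := by
  unfold quad dotProduct Matrix.mulVec dotProduct; fun_prop

theorem continuous_liftedPower : Continuous (liftedPower : Lifted N M → ℝ) :=
  continuous_finsetSum _ fun m _ => Complex.continuous_re.comp (continuous_apply m).matrix_trace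

theorem continuous_liftedRowPower (n : Fin N) :
    Continuous fun S : Lifted N M => liftedRowPower S n := by
  unfold liftedRowPower
  fun_prop

theorem isClosed_socConstraint (P : Instance N M) :
    IsClosed {W : Beam N M | socConstraint P W} := by
  have hg := fun j m : Fin M => continuous_gain (N := N) j (P.H.col m)
  simp only [socConstraint, Set.ofPred_forall]
  refine isClosed_iInter fun m => isClosed_le ?_ ?_
  · exact (Continuous.add (continuous_finsetSum _ fun l _ => (hg l m).norm.pow 2)
      continuous_const).sqrt
  · exact continuous_const.mul (Complex.continuous_re.comp (hg m m))

theorem isClosed_posSemidef : IsClosed {S : Matrix (Fin N) (Fin N) ℂ | S.PosSemidef} := by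
  simp only [posSemidef_iff_quad, Set.ofPred_and, Set.ofPred_forall]
  refine IsClosed.inter ?_ (isClosed_iInter fun h => isClosed_le continuous_const (continuous_quad h))
  exact isClosed_eq continuous_id.matrix_conjTranspose continuous_id

/-- Positive noise makes the denominators positive. Cleared of them, the constraints are affine in S
for each fixed h, hence closed. -/
theorem sdrConstraint_iff {P : Instance N M} (hσ : ∀ m, 0 < P.σ m) (S : Lifted N M) :
    sdrConstraint P S ↔ (∀ m, (S m).PosSemidef) ∧ ∀ m, ∀ h ∈ channelBall P m,
      P.γ m * (∑ l ∈ Finset.univ.erase m, quad (S l) h + P.σ m ^ 2) ≤ quad (S m) h := by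
  refine and_congr_right fun hS => forall_congr' fun m => forall₂_congr fun h _ => ?_
  rw [le_div_iff₀]
  have := hσ m
  have h2 : 0 ≤ ∑ l ∈ Finset.univ.erase m, quad (S l) h :=
    Finset.sum_nonneg fun l _ => quad_nonneg (hS l) h
  positivity

theorem isClosed_sdrConstraint {P : Instance N M} (hσ : ∀ m, 0 < P.σ m) :
    IsClosed {S : Lifted N M | sdrConstraint P S} := by
  simp only [sdrConstraint_iff hσ, Set.ofPred_and, Set.ofPred_forall]
  refine IsClosed.inter (isClosed_iInter fun m => ?_) (isClosed_iInter fun m =>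
    isClosed_iInter fun h => isClosed_iInter fun _ => isClosed_le ?_ ?_)
  · exact (isClosed_posSemidef (N := N)).preimage (f := fun S : Lifted N M => S m) (continuous_apply m)
  · exact continuous_const.mul (Continuous.add (continuous_finsetSum _ fun l _ =>
      (continuous_quad h).comp (continuous_apply l)) continuous_const)
  · exact (continuous_quad h).comp (continuous_apply m)

theorem norm_entry_le_power (W : Beam N M) (n : Fin N) (m : Fin M) : ‖W n m‖ ≤ power W + 1 := by
  have h1 : ‖W n m‖ ^ 2 ≤ ∑ m, ‖W n m‖ ^ 2 :=
    Finset.single_le_sum (f := fun m => ‖W n m‖ ^ 2) (fun _ _ => by positivity) (Finset.mem_univ m)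
  have h2 : ∑ m, ‖W n m‖ ^ 2 ≤ power W :=
    Finset.single_le_sum (f := fun n => ∑ m, ‖W n m‖ ^ 2)
      (fun _ _ => Finset.sum_nonneg fun _ _ => by positivity) (Finset.mem_univ n)
  nlinarith [sq_nonneg (‖W n m‖ - 1)]

theorem norm_entry_le_liftedPower {S : Lifted N M} (hS : ∀ m, (S m).PosSemidef) (m : Fin M)
    (i j : Fin N) : ‖S m i j‖ ≤ liftedPower S :=
  (norm_entry_le_trace (hS m) i j).trans <|
    Finset.single_le_sum (f := fun m => (S m).trace.re) (fun l _ => trace_re_nonneg (hS l))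
      (Finset.mem_univ m)

theorem exists_isSolver_socp (P : Instance N M) : ∃ solve, IsSolver (socp P) solve := by
  refine exists_isSolver _ fun B hne => exists_isMinimum ?_ continuous_power (fun r => ?_) hne
  · have : IsClosed {W : Beam N M | ∀ n ∈ B, W.row n = 0} := by
      simp only [Set.ofPred_forall]
      exact isClosed_iInter fun n => isClosed_iInter fun _ =>
        isClosed_eq (continuous_row n) continuous_const
    exact (isClosed_socConstraint P).inter this
  · refine ⟨_, isCompact_entries_le (r + 1), fun W _ hr n m => ?_⟩
    have h1 : power W ≤ r := hr
    exact (norm_entry_le_power W n m).trans (by linarith)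

theorem exists_isSolver_sdr {P : Instance N M} (hσ : ∀ m, 0 < P.σ m) :
    ∃ solve, IsSolver (sdr P) solve := by
  refine exists_isSolver _ fun B hne => exists_isMinimum ?_ continuous_liftedPower (fun r => ?_) hne
  · have : IsClosed {S : Lifted N M | ∀ m, ∀ n ∈ B, (S m).row n = 0} := by
      simp only [Set.ofPred_forall]
      exact isClosed_iInter fun m => isClosed_iInter fun n => isClosed_iInter fun _ =>
        isClosed_eq ((continuous_row n).comp (continuous_apply m)) continuous_const
    exact (isClosed_sdrConstraint hσ).inter this
  · exact ⟨_, isCompact_lifted_entries_le r, fun S hS hr m i j =>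
      (norm_entry_le_liftedPower hS.1.1 m i j).trans hr⟩

theorem isClosed_boolRelaxed (ν : Node N) : IsClosed {z : Fin N → ℝ | boolRelaxed L ν z} := by
  simp only [boolRelaxed, Set.ofPred_and, Set.ofPred_forall]
  refine IsClosed.inter ?_ (IsClosed.inter ?_ (IsClosed.inter ?_ ?_))
  · exact isClosed_iInter fun n => (isClosed_le continuous_const (continuous_apply n)).inter
      (isClosed_le (continuous_apply n) continuous_const)
  · exact isClosed_le (continuous_finsetSum _ fun n _ => continuous_apply n) continuous_const
  · exact isClosed_iInter fun n => isClosed_iInter fun _ =>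
      isClosed_eq (continuous_apply n) continuous_const
  · exact isClosed_iInter fun n => isClosed_iInter fun _ =>
      isClosed_eq (continuous_apply n) continuous_const

theorem boolRelaxed.mem_Icc {ν : Node N} {z : Fin N → ℝ} (h : boolRelaxed L ν z) :
    z ∈ Set.Icc (0 : Fin N → ℝ) 1 := ⟨fun n => (h.1 n).1, fun n => (h.1 n).2⟩

theorem exists_isSolver_bigMSocp (P : Instance N M) (C : ℝ) :
    ∃ solve, IsSolver (bigMSocp P L C) solve := by
  refine exists_isSolver _ fun ν hne => exists_isMinimum ?_
    (continuous_power.comp continuous_fst) (fun r => ?_) hne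
  · have h : IsClosed {Y : Beam N M × (Fin N → ℝ) | ∀ n, √(rowPower Y.1 n) ≤ C * Y.2 n} := by
      simp only [Set.ofPred_forall]
      exact isClosed_iInter fun n => isClosed_le
        ((continuous_rowPower n).comp continuous_fst).sqrt
        (continuous_const.mul ((continuous_apply n).comp continuous_snd))
    exact ((isClosed_socConstraint P).preimage continuous_fst).inter
      (((isClosed_boolRelaxed ν).preimage continuous_snd).inter h)
  · refine ⟨_, (isCompact_entries_le (r + 1)).prod isCompact_Icc, fun Y hY hr =>
      ⟨fun n m => ?_, hY.2.1.mem_Icc⟩⟩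
    have h1 : power Y.1 ≤ r := hr
    exact (norm_entry_le_power Y.1 n m).trans (by linarith)

theorem exists_isSolver_bigMSdr {P : Instance N M} (hσ : ∀ m, 0 < P.σ m) (C : ℝ) :
    ∃ solve, IsSolver (bigMSdr P L C) solve := by
  refine exists_isSolver _ fun ν hne => exists_isMinimum ?_
    (continuous_liftedPower.comp continuous_fst) (fun r => ?_) hne
  · have h : IsClosed {Y : Lifted N M × (Fin N → ℝ) |
        ∀ n, liftedRowPower Y.1 n ≤ C ^ 2 * Y.2 n} := by
      simp only [Set.ofPred_forall]
      exact isClosed_iInter fun n => isClosed_le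
        ((continuous_liftedRowPower n).comp continuous_fst)
        (continuous_const.mul ((continuous_apply n).comp continuous_snd))
    exact ((isClosed_sdrConstraint hσ).preimage continuous_fst).inter
      (((isClosed_boolRelaxed ν).preimage continuous_snd).inter h)
  · exact ⟨_, (isCompact_lifted_entries_le r).prod isCompact_Icc, fun Y hY hr =>
      ⟨fun m i j => (norm_entry_le_liftedPower hY.1.1 m i j).trans hr, hY.2.1.mem_Icc⟩⟩

/-! ### Solvers and relaxations -/

theorem solvedValue_le {X : Type} {p : Finset (Fin N) → Program X}
    {solve : Finset (Fin N) → Option X} (h : IsSolver p solve) {value : X → ℝ}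
    {T : Finset (Fin N)} (hv : (p T).objective = value) {y : X} (hy : y ∈ (p T).feasible) :
    solvedValue solve value T ≤ ENNReal.ofReal (value y) := by
  unfold solvedValue
  cases hs : solve T with
  | none => rw [(h T).2 hs] at hy; exact absurd hy (Set.notMem_empty y)
  | some x =>
    have := ((h T).1 x hs).2 y hy
    rw [hv] at this
    exact ENNReal.ofReal_le_ofReal this

theorem solvedValue_mono {X : Type} {p : Finset (Fin N) → Program X}
    {solve : Finset (Fin N) → Option X} (h : IsSolver p solve) {value : X → ℝ}
    (hv : ∀ T, (p T).objective = value) {B T : Finset (Fin N)}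
    (hBT : (p T).feasible ⊆ (p B).feasible) :
    solvedValue solve value B ≤ solvedValue solve value T := by
  cases hs : solve T with
  | none => simp [solvedValue, hs]
  | some x =>
    have h1 : solvedValue solve value T = ENNReal.ofReal (value x) := by simp [solvedValue, hs]
    rw [h1]
    exact solvedValue_le h (hv B) (hBT ((h T).1 x hs).1)

theorem rowZero_le {W : Beam N M} {T : Finset (Fin N)} (hLN : L ≤ N) (hT : T.card = N - L)
    (hW : ∀ n ∈ T, W.row n = 0) : rowZero W ≤ L := by
  have h1 : {n : Fin N | W.row n ≠ 0} ⊆ ((Tᶜ : Finset (Fin N)) : Set (Fin N)) := by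
    intro n hn
    simp only [Finset.coe_compl, Set.mem_compl_iff, Finset.mem_coe]
    exact fun hnT => hn (hW n hnT)
  have h2 := Set.ncard_le_ncard h1 (Finset.finite_toSet _)
  rw [Set.ncard_coe_finset, Finset.card_compl, Fintype.card_fin] at h2
  unfold rowZero
  omega

theorem exists_shutDown {W : Beam N M} (hLN : L ≤ N) (hW : rowZero W ≤ L) :
    ∃ T : Finset (Fin N), T.card = N - L ∧ ∀ n ∈ T, W.row n = 0 := by
  classical
  have h1 : (Finset.univ.filter fun n : Fin N => W.row n ≠ 0).card ≤ L := by
    rw [rowZero, Set.ncard_eq_toFinset_card'] at hW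
    simpa using hW
  have h2 := Finset.card_filter_add_card_filter_not (s := Finset.univ)
    (fun n : Fin N => W.row n ≠ 0)
  simp only [Finset.card_univ, Fintype.card_fin, not_not] at h2
  obtain ⟨T, hT, hc⟩ := Finset.exists_subset_card_eq
    (s := Finset.univ.filter fun n : Fin N => W.row n = 0) (n := N - L) (by omega)
  exact ⟨T, hc, fun n hn => (Finset.mem_filter.1 (hT hn)).2⟩

/-! ### Perfect CSI -/

theorem le_sinr_of_socConstraint {P : Instance N M} (hσ : ∀ m, 0 < P.σ m) (hγ : ∀ m, 0 < P.γ m)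
    {W : Beam N M} (h : socConstraint P W) (m : Fin M) : P.γ m ≤ sinr P W m (P.H.col m) := by
  have hm := h m
  have h1 := hσ m
  have h2 := hγ m
  set I := ∑ l ∈ Finset.univ.erase m, ‖gain W l (P.H.col m)‖ ^ 2 + P.σ m ^ 2 with hI
  have hpos : 0 < I := by
    have : 0 ≤ ∑ l ∈ Finset.univ.erase m, ‖gain W l (P.H.col m)‖ ^ 2 :=
      Finset.sum_nonneg fun l _ => by positivity
    positivity
  rw [sinr, le_div_iff₀ hpos]
  have hs : 0 < √(P.γ m) := Real.sqrt_pos.2 h2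
  rw [one_div, inv_mul_eq_div, le_div_iff₀ hs] at hm
  have h3 : (√I * √(P.γ m)) ^ 2 ≤ ‖gain W m (P.H.col m)‖ ^ 2 := by
    gcongr
    exact hm.trans ((le_abs_self _).trans (Complex.abs_re_le_norm _))
  rw [mul_pow, Real.sq_sqrt hpos.le, Real.sq_sqrt h2.le] at h3
  linarith

theorem exists_unit_mul_eq_norm (z : ℂ) : ∃ c : ℂ, ‖c‖ = 1 ∧ star c * z = ‖z‖ := by
  by_cases hz : z = 0
  · exact ⟨1, by simp [hz]⟩
  · have h0 : (‖z‖ : ℂ) ≠ 0 := by simpa using hz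
    refine ⟨z / ‖z‖, by simp [hz], ?_⟩
    rw [RCLike.star_def, map_div₀, Complex.conj_ofReal, div_mul_eq_mul_div, Complex.conj_mul']
    field_simp

/-- Rotating the phases of the beamformers turns the SINR constraints into second-order cone
constraints. -/
theorem exists_socConstraint {P : Instance N M} (hσ : ∀ m, 0 < P.σ m) (hγ : ∀ m, 0 < P.γ m)
    {W : Beam N M} (h : ∀ m, P.γ m ≤ sinr P W m (P.H.col m)) :
    ∃ W' : Beam N M, socConstraint P W' ∧ power W' = power W ∧
      ∀ n, W.row n = 0 → W'.row n = 0 := by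
  choose c hc1 hc using fun m => exists_unit_mul_eq_norm (gain W m (P.H.col m))
  have hgain : ∀ j x, gain (Matrix.of fun n m => W n m * c m) j x = star (c j) * gain W j x := by
    intro j x
    simp only [gain, dotProduct, Finset.mul_sum]
    refine Finset.sum_congr rfl fun n _ => ?_
    simp
    ring
  refine ⟨Matrix.of fun n m => W n m * c m, fun m => ?_, ?_, fun n hn => ?_⟩
  · have hm := h m
    have h1 := hσ m
    have h2 := hγ m
    have hs : 0 < √(P.γ m) := Real.sqrt_pos.2 h2
    simp only [hgain, norm_mul, norm_star, hc1, one_mul]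
    rw [hc, Complex.ofReal_re]
    set I := ∑ l ∈ Finset.univ.erase m, ‖gain W l (P.H.col m)‖ ^ 2 + P.σ m ^ 2 with hI
    have hpos : 0 < I := by
      have : 0 ≤ ∑ l ∈ Finset.univ.erase m, ‖gain W l (P.H.col m)‖ ^ 2 :=
        Finset.sum_nonneg fun l _ => by positivity
      positivity
    rw [sinr, ← hI, le_div_iff₀ hpos] at hm
    rw [one_div, inv_mul_eq_div, le_div_iff₀ hs, ← Real.sqrt_mul hpos.le]
    refine Real.sqrt_le_iff.2 ⟨norm_nonneg _, by linarith⟩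
  · simp [power, hc1]
  · ext m
    have := congrFun hn m
    simp only [Matrix.row_apply, Pi.zero_apply] at this
    simp [this]

theorem exactOnLeaves_socp {P : Instance N M} (hLN : L ≤ N) (hσ : ∀ m, 0 < P.σ m)
    (hγ : ∀ m, 0 < P.γ m) {solve : Finset (Fin N) → Option (Beam N M)}
    (h : IsSolver (socp P) solve) : ExactOnLeaves solve power some L (bfas P L) := by
  refine ⟨fun T W hT hs => ⟨W, rfl, ?_, rfl⟩, fun B T hBT => ?_, fun W hW => ?_⟩
  · obtain ⟨⟨h1, h2⟩, -⟩ := (h T).1 W hs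
    exact ⟨le_sinr_of_socConstraint hσ hγ h1, rowZero_le hLN hT h2⟩
  · exact solvedValue_mono h (fun _ => rfl) fun W hW => ⟨hW.1, fun n hn => hW.2 n (hBT hn)⟩
  · obtain ⟨T, hT, hz⟩ := exists_shutDown hLN hW.2
    obtain ⟨W', h1, h2, h3⟩ := exists_socConstraint hσ hγ hW.1
    refine ⟨T, hT, ?_⟩
    rw [← h2]
    exact solvedValue_le h rfl ⟨h1, fun n hn => h3 n (hz n hn)⟩

/-! ### Tightness of the semidefinite relaxation -/

theorem mul_complProj {ι κ : Type} [Fintype ι] [DecidableEq ι] [Fintype κ] [DecidableEq κ]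
    (G : Matrix ι κ ℂ) (hG : IsUnit (Gᴴ * G).det) : Gᴴ * complProj G = 0 := by
  rw [complProj, Matrix.mul_sub, Matrix.mul_one, ← Matrix.mul_assoc, ← Matrix.mul_assoc,
    Matrix.mul_nonsing_inv _ hG, Matrix.one_mul, sub_self]

/-- The projection differs from h by a combination of the columns of G, to all of which it is
orthogonal. -/
theorem star_complProj_mulVec_dotProduct {ι κ : Type} [Fintype ι] [DecidableEq ι] [Fintype κ]
    [DecidableEq κ] (G : Matrix ι κ ℂ) (hG : IsUnit (Gᴴ * G).det) (h : ι → ℂ) :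
    star (complProj G *ᵥ h) ⬝ᵥ h = star (complProj G *ᵥ h) ⬝ᵥ (complProj G *ᵥ h) ∧
      ∀ k, star (complProj G *ᵥ h) ⬝ᵥ G.col k = 0 := by
  have h0 : Gᴴ *ᵥ (complProj G *ᵥ h) = 0 := by
    rw [Matrix.mulVec_mulVec, mul_complProj G hG, Matrix.zero_mulVec]
  have h1 : ∀ c, star (complProj G *ᵥ h) ⬝ᵥ (G *ᵥ c) = 0 := by
    intro c
    have := congrArg star h0
    rw [Matrix.star_mulVec, Matrix.conjTranspose_conjTranspose] at this
    rw [Matrix.dotProduct_mulVec, this]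
    simp
  refine ⟨?_, fun k => ?_⟩
  · have h2 : h = complProj G *ᵥ h + G *ᵥ (((Gᴴ * G)⁻¹ * Gᴴ) *ᵥ h) := by
      rw [Matrix.mulVec_mulVec, ← Matrix.add_mulVec, complProj, ← Matrix.mul_assoc,
        sub_add_cancel, Matrix.one_mulVec]
    conv_lhs => arg 2; rw [h2]
    rw [dotProduct_add, h1, add_zero]
  · have := h1 (Pi.single k 1)
    rwa [Matrix.mulVec_single_one] at this

/-- The zero-forcing directions: unit vectors that use only the antennas outside of `T` and cause
no interference. -/
theorem exists_zeroForcing {P : Instance N M} (hε : ∀ m, 0 < P.ε m) (hγ : ∀ m, 0 < P.γ m)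
    (hM : 0 < M) (hcond : sdrCondition P L) {T : Finset (Fin N)} (hT : L ≤ Tᶜ.card) (m : Fin M) :
    ∃ (v : Fin N → ℂ) (R : ℝ), ∑ i, ‖v i‖ ^ 2 = 1 ∧ (∀ n ∈ T, v n = 0) ∧
      (∀ l, l ≠ m → star v ⬝ᵥ P.H.col l = 0) ∧ star v ⬝ᵥ P.H.col m = R ∧ 0 < R ∧
      1 + (M : ℝ) + ((M : ℝ) - 1 / (M : ℝ)) * P.γ m < R ^ 2 / P.ε m ^ 2 := by
  obtain ⟨hG, hlt⟩ := hcond Tᶜ hT m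
  set G : Matrix (Tᶜ : Finset (Fin N)) {j : Fin M // j ≠ m} ℂ :=
    P.H.submatrix Subtype.val Subtype.val with hGdef
  set h : (Tᶜ : Finset (Fin N)) → ℂ := fun n => P.H n m with hh
  set w := complProj G *ᵥ h with hw
  obtain ⟨h1, h2⟩ := star_complProj_mulVec_dotProduct G hG h
  rw [EuclideanSpace.norm_sq_eq] at hlt
  rw [← hw, star_dotProduct_self] at h1
  set c : ℝ := ∑ i, ‖w i‖ ^ 2 with hc
  have hc' : 1 + (M : ℝ) + ((M : ℝ) - 1 / (M : ℝ)) * P.γ m < c / P.ε m ^ 2 := hlt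
  have hM1 : (1 : ℝ) ≤ M := by exact_mod_cast hM
  have hcpos : 0 < c := by
    have h3 : 1 / (M : ℝ) ≤ 1 := by rw [div_le_one (by linarith)]; exact hM1
    have h4 : 0 < 1 + (M : ℝ) + ((M : ℝ) - 1 / (M : ℝ)) * P.γ m := by
      have := mul_nonneg (show 0 ≤ (M : ℝ) - 1 / (M : ℝ) by linarith) (hγ m).le
      linarith
    have h5 : 0 < P.ε m ^ 2 := by have := hε m; positivity
    have h6 := h4.trans hc'
    rwa [div_pos_iff_of_pos_right h5] at h6
  have hs := Real.sqrt_pos.2 hcpos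
  have hss : √c * √c = c := Real.mul_self_sqrt hcpos.le
  -- The normalized projected channel, extended by zero to the antennas in T; its gain on the
  -- channel of user m is R = √c = ‖w‖.
  let v : Fin N → ℂ := fun n => if hn : n ∈ Tᶜ then ((√c)⁻¹ : ℂ) * w ⟨n, hn⟩ else 0
  have hvS : ∀ n : (Tᶜ : Finset (Fin N)), v n = ((√c)⁻¹ : ℂ) * w n := fun n => dif_pos n.2
  have hvT : ∀ n ∈ T, v n = 0 := fun n hn => dif_neg (by simpa using hn)
  have hsum : ∀ {R : Type} [AddCommMonoid R] (f : Fin N → R), (∀ n ∈ T, f n = 0) →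
      ∑ n, f n = ∑ n : (Tᶜ : Finset (Fin N)), f n := by
    intro R _ f hf
    rw [Finset.sum_coe_sort Tᶜ f]
    refine (Finset.sum_subset (Finset.subset_univ _) fun n _ hn => hf n ?_).symm
    simpa using hn
  have hdot : ∀ l, star v ⬝ᵥ P.H.col l =
      ((√c)⁻¹ : ℂ) * (star w ⬝ᵥ fun n : (Tᶜ : Finset (Fin N)) => P.H n l) := by
    intro l
    rw [dotProduct, hsum _ fun n hn => by simp [hvT n hn], dotProduct, Finset.mul_sum]
    refine Finset.sum_congr rfl fun n _ => ?_
    rw [Pi.star_apply, hvS n]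
    simp [Complex.conj_ofReal, mul_assoc]
  refine ⟨v, √c, ?_, hvT, fun l hl => ?_, ?_, hs, ?_⟩
  · rw [hsum _ fun n hn => by simp [hvT n hn]]
    simp only [hvS, norm_mul, mul_pow, norm_inv, Complex.norm_real,
      Real.norm_of_nonneg (Real.sqrt_nonneg c), ← Finset.mul_sum]
    rw [← hc, inv_pow, Real.sq_sqrt hcpos.le, inv_mul_cancel₀ hcpos.ne']
  · rw [hdot]
    have h3 : star w ⬝ᵥ (fun n : (Tᶜ : Finset (Fin N)) => P.H n l) = 0 := h2 ⟨l, hl⟩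
    rw [h3, mul_zero]
  · rw [hdot, h1, ← Complex.ofReal_inv, ← Complex.ofReal_mul]
    congr 1
    rw [inv_mul_eq_div, div_eq_iff hs.ne', hss]
  · rwa [Real.sq_sqrt hcpos.le]

/-- With y² = (μ - 1)γ the bound on R²/ε² exceeds (1 + y)² by (y - μ)²/μ ≥ 0, so R ≥ (1 + y)ε. In
use, μ = M and the worst-case zero-forcing gain (R - ε)² pays for the interference of the M - 1
other zero-forcing beams. -/
theorem mul_sq_le_sub_sq {μ γ ε R : ℝ} (hμ : 1 ≤ μ) (hγ : 0 < γ) (hε : 0 < ε) (hR : 0 < R)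
    (h : 1 + μ + (μ - 1 / μ) * γ < R ^ 2 / ε ^ 2) :
    ε ≤ R ∧ (μ - 1) * γ * ε ^ 2 ≤ (R - ε) ^ 2 := by
  have hy0 : 0 ≤ (μ - 1) * γ := mul_nonneg (by linarith) hγ.le
  set y := √((μ - 1) * γ) with hy
  have hyy : y ^ 2 = (μ - 1) * γ := Real.sq_sqrt hy0
  have hyn : 0 ≤ y := Real.sqrt_nonneg _
  rw [lt_div_iff₀ (by positivity)] at h
  have h1 : (1 + y) ^ 2 ≤ 1 + μ + (μ - 1 / μ) * γ := by
    have h2 : 1 + μ + (μ - 1 / μ) * γ - (1 + y) ^ 2 = (y - μ) ^ 2 / μ := by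
      have h3 : (μ - 1 / μ) * γ = (1 + 1 / μ) * y ^ 2 := by rw [hyy]; field_simp; ring
      rw [h3]; field_simp; ring
    have h4 : 0 ≤ (y - μ) ^ 2 / μ := by positivity
    linarith
  have h2 : ((1 + y) * ε) ^ 2 ≤ R ^ 2 := by
    rw [mul_pow]
    exact (mul_le_mul_of_nonneg_right h1 (by positivity)).trans h.le
  have h3 : (1 + y) * ε ≤ R := (pow_le_pow_iff_left₀ (by positivity) hR.le two_ne_zero).1 h2
  have h4 : y * ε ≤ R - ε := by linarith
  have h5 : 0 ≤ y * ε := by positivity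
  refine ⟨by linarith, ?_⟩
  rw [← hyy, ← mul_pow]
  gcongr

/-- The budget for the user whose matrix is changed, per unit of removed trace: lost signal plus γ
times added interference must not exceed the added signal, for every component x of the channel
error along v. The condition μτ < 1 makes the exchange save power. -/
theorem exists_perturbation {μ γ ε R : ℝ} (hμ : 1 ≤ μ) (hγ : 0 < γ) (hε : 0 < ε) (hR : 0 < R)
    (h : 1 + μ + (μ - 1 / μ) * γ < R ^ 2 / ε ^ 2) :
    ∃ τ k : ℝ, 0 < τ ∧ μ * τ < 1 ∧ 0 ≤ k ∧ ∀ x, |x| ≤ ε →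
      ε ^ 2 + 2 * k * x + k ^ 2 + γ * ((μ - 1) * ε ^ 2 * τ) ≤ τ * (R + x) ^ 2 := by
  obtain ⟨hεR, -⟩ := mul_sq_le_sub_sq hμ hγ hε hR h
  rw [lt_div_iff₀ (by positivity)] at h
  have hμ0 : 0 < μ := by linarith
  -- The slack of the inequality at the borderline τ = 1/μ, multiplied by μ and minimized over real
  -- x; it is positive exactly by the hypothesis on R²/ε².
  set g := μ * R ^ 2 / (μ + 1) - μ * ε ^ 2 - (μ - 1) * γ * ε ^ 2 with hg
  have hgpos : 0 < g := by
    have h1 : g = μ / (μ + 1) * (R ^ 2 - (1 + μ + (μ - 1 / μ) * γ) * ε ^ 2) := by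
      rw [hg]; field_simp; ring
    rw [h1]
    have : 0 < R ^ 2 - (1 + μ + (μ - 1 / μ) * γ) * ε ^ 2 := by linarith
    positivity
  have hglt : g < (R + ε) ^ 2 := by
    have h1 : μ * R ^ 2 / (μ + 1) ≤ R ^ 2 := by
      rw [div_le_iff₀ (by linarith)]; nlinarith [sq_nonneg R]
    have h2 : 0 ≤ (μ - 1) * γ * ε ^ 2 :=
      mul_nonneg (mul_nonneg (by linarith) hγ.le) (by positivity)
    have h3 : 0 < μ * ε ^ 2 := by positivity
    nlinarith [mul_pos hR hε, sq_nonneg ε]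
  -- As (R + x)² ≤ (R + ε)², lowering τ from 1/μ to (1 - η)/μ costs at most the slack g.
  set η := g / (R + ε) ^ 2 with hη
  have hη0 : 0 < η := by positivity
  have hη1 : η < 1 := (div_lt_one (by positivity)).2 hglt
  have hηg : η * (R + ε) ^ 2 = g := div_mul_cancel₀ _ (by positivity)
  refine ⟨(1 - η) / μ, R / (μ + 1), div_pos (by linarith) hμ0, ?_, by positivity, fun x hx => ?_⟩
  · rw [mul_div_cancel₀ _ hμ0.ne']; linarith
  · obtain ⟨hx1, hx2⟩ := abs_le.1 hx
    set k := R / (μ + 1) with hk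
    -- Completing the square in x; k = R/(μ + 1) maximizes the remaining constant.
    have hid : (R + x) ^ 2 - μ * (ε ^ 2 + 2 * k * x + k ^ 2) =
        (R + x - μ * k) ^ 2 + (μ * R ^ 2 / (μ + 1) - μ * ε ^ 2) := by
      rw [hk]; field_simp; ring
    have hsq : (R + x) ^ 2 ≤ (R + ε) ^ 2 := by
      have : 0 ≤ R + x := by linarith
      gcongr
    have h1 : η * (R + x) ^ 2 ≤ g := hηg ▸ mul_le_mul_of_nonneg_left hsq hη0.le
    have h2 : 0 ≤ η * ((μ - 1) * γ * ε ^ 2) :=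
      mul_nonneg hη0.le (mul_nonneg (mul_nonneg (by linarith) hγ.le) (by positivity))
    have h3 : μ * (ε ^ 2 + 2 * k * x + k ^ 2) ≤
        (1 - η) * ((R + x) ^ 2 - (μ - 1) * γ * ε ^ 2) := by
      nlinarith [sq_nonneg (R + x - μ * k)]
    have h4 : ε ^ 2 + 2 * k * x + k ^ 2 ≤
        (1 - η) * ((R + x) ^ 2 - (μ - 1) * γ * ε ^ 2) / μ := by
      rw [le_div_iff₀ hμ0]; linarith
    calc _ ≤ (1 - η) * ((R + x) ^ 2 - (μ - 1) * γ * ε ^ 2) / μ +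
          γ * ((μ - 1) * ε ^ 2 * ((1 - η) / μ)) := by gcongr
      _ = _ := by ring

/-- A vector in the kernel of a hermitian matrix produces no cross terms. For q = h_m - k v_m the
removed part D therefore acts only on the small vector e + k v_m. -/
theorem quad_eq_of_mulVec_eq_zero {D : Matrix (Fin N) (Fin N) ℂ} (hD : D.IsHermitian)
    {q : Fin N → ℂ} (hq : D *ᵥ q = 0) (f : Fin N → ℂ) : quad D (q + f) = quad D f := by
  have h1 : star q ᵥ* D = 0 := by
    have := congrArg star hq
    rwa [Matrix.star_mulVec, hD.eq, star_zero] at this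
  rw [quad, quad, Matrix.mulVec_add, hq, zero_add, star_add, add_dotProduct,
    Matrix.dotProduct_mulVec (star q), h1, zero_dotProduct, zero_add]

theorem sum_normSq_add_smul (e v : Fin N → ℂ) (k : ℝ) :
    ∑ i, ‖(e + (k : ℂ) • v) i‖ ^ 2 =
      ∑ i, ‖e i‖ ^ 2 + 2 * k * (star v ⬝ᵥ e).re + k ^ 2 * ∑ i, ‖v i‖ ^ 2 := by
  rw [dotProduct, Complex.re_sum, Finset.mul_sum, Finset.mul_sum, ← Finset.sum_add_distrib,
    ← Finset.sum_add_distrib]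
  refine Finset.sum_congr rfl fun i _ => ?_
  simp only [Complex.sq_norm, Complex.normSq_apply, Pi.add_apply, Pi.smul_apply, smul_eq_mul,
    Complex.add_re, Complex.add_im, Complex.mul_re, Complex.mul_im, Complex.ofReal_re,
    Complex.ofReal_im, Pi.star_apply, RCLike.star_def, Complex.conj_re, Complex.conj_im]
  ring

theorem sum_normSq_le_of_mem_channelBall {P : Instance N M} {m : Fin M}
    {h : Fin N → ℂ} (hh : h ∈ channelBall P m) :
    ∑ i, ‖(h - P.H.col m) i‖ ^ 2 ≤ P.ε m ^ 2 := by
  have h1 : ‖(WithLp.toLp 2 (h - P.H.col m) : EuclideanSpace ℂ (Fin N))‖ ^ 2 ≤ P.ε m ^ 2 := by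
    gcongr
    exact hh
  rwa [EuclideanSpace.norm_sq_eq] at h1

/-- Under the condition on the channels, every optimal solution of the relaxation that uses
`L` antennas has rank one. -/
theorem exists_eq_vecMulVec_of_optimal {P : Instance N M} (hLN : L ≤ N)
    (hσ : ∀ m, 0 < P.σ m) (hγ : ∀ m, 0 < P.γ m) (hε : ∀ m, 0 < P.ε m) (hcond : sdrCondition P L)
    {T : Finset (Fin N)} (hT : T.card = N - L) {S : Lifted N M} (hS : S ∈ (sdr P T).feasible)
    (hopt : ∀ S' ∈ (sdr P T).feasible, liftedPower S ≤ liftedPower S') (m : Fin M) :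
    ∃ a : Fin N → ℂ, S m = Matrix.vecMulVec a (star a) := by
  have hM : 0 < M := m.pos
  have hμ : (1 : ℝ) ≤ M := by exact_mod_cast hM
  have hTc : L ≤ Tᶜ.card := by rw [Finset.card_compl, Fintype.card_fin]; omega
  choose v R hv1 hvT hv0 hvR hRpos hR using
    fun j => exists_zeroForcing hε hγ hM hcond hTc j
  obtain ⟨τ, k, hτ, hMτ, hk, hpert⟩ := exists_perturbation hμ (hγ m) (hε m) (hRpos m) (hR m)
  have hS' := (sdrConstraint_iff hσ S).1 hS.1
  obtain ⟨a, D, hD, hDq, hSm⟩ := exists_rankOne_add (hS'.1 m) (P.H.col m - (k : ℂ) • v m)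
  refine ⟨a, ?_⟩
  by_contra hne
  set d := D.trace.re with hd
  have hdpos : 0 < d := by
    refine lt_of_le_of_ne (trace_re_nonneg hD) fun h0 => hne ?_
    have : D = 0 := by
      rw [← hD.trace_eq_zero_iff]
      exact Complex.ext h0.symm (Complex.le_def.1 hD.trace_nonneg).2.symm
    rw [hSm, this, add_zero]
  set A := Matrix.vecMulVec a (star a) with hA
  have hApsd : A.PosSemidef := Matrix.posSemidef_vecMulVec_self_star a
  set V : Fin M → Matrix (Fin N) (Fin N) ℂ := fun j => Matrix.vecMulVec (v j) (star (v j)) with hV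
  set B : Lifted N M := Function.update S m A with hB
  have hBpsd : ∀ j, (B j).PosSemidef := by
    intro j
    by_cases hj : j = m
    -- `B` is the old solution with D removed from user m.
    · subst hj; simpa [hB] using hApsd
    · simpa [hB, hj] using hS'.1 j
  have hBle : ∀ j h, quad (B j) h ≤ quad (S j) h := by
    intro j h
    by_cases hj : j = m
    · subst hj
      rw [hSm, quad_add]
      have := quad_nonneg hD h
      simpa [hB] using this
    · simp [hB, hj]
  have hdτ : 0 < d * τ := mul_pos hdpos hτ
  have hquad : ∀ j h, quad (B j + ((d * τ : ℝ) : ℂ) • V j) h =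
      quad (B j) h + d * τ * ‖star (v j) ⬝ᵥ h‖ ^ 2 := by
    intro j h
    rw [quad_add, quad_smul, quad_vecMulVec]
  -- The exchange: D is replaced by zero-forcing beams of power dτ for all users. Since v_l is
  -- orthogonal to the nominal channel of every j ≠ l, only the channel error lets such a beam
  -- interfere.
  have hfeas : (fun j => B j + ((d * τ : ℝ) : ℂ) • V j) ∈ (sdr P T).feasible := by
    refine ⟨(sdrConstraint_iff hσ _).2 ⟨fun j => ?_, fun j h hh => ?_⟩, fun j n hn => ?_⟩
    · refine (hBpsd j).add ((Matrix.posSemidef_vecMulVec_self_star (v j)).smul ?_)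
      exact_mod_cast hdτ.le
    · have hold := hS'.2 j h hh
      set e := h - P.H.col j with he
      have hen : ∑ i, ‖e i‖ ^ 2 ≤ P.ε j ^ 2 := sum_normSq_le_of_mem_channelBall hh
      have hhe : h = P.H.col j + e := by rw [he]; abel
      have hve : ∀ l, ‖star (v l) ⬝ᵥ e‖ ^ 2 ≤ P.ε j ^ 2 := by
        intro l
        have := normSq_dotProduct_le (v l) e
        rw [hv1, one_mul] at this
        exact this.trans hen
      have hvl : ∀ l ∈ Finset.univ.erase j, ‖star (v l) ⬝ᵥ h‖ ^ 2 ≤ P.ε j ^ 2 := by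
        intro l hl
        rw [hhe, dotProduct_add, hv0 l j (Finset.ne_of_mem_erase hl).symm, zero_add]
        exact hve l
      have hsumv : ∑ l ∈ Finset.univ.erase j, ‖star (v l) ⬝ᵥ h‖ ^ 2 ≤
          ((M : ℝ) - 1) * P.ε j ^ 2 := by
        refine (Finset.sum_le_card_nsmul _ _ _ hvl).trans_eq ?_
        rw [Finset.card_erase_of_mem (Finset.mem_univ j), Finset.card_univ, Fintype.card_fin,
          nsmul_eq_mul, Nat.cast_sub hM, Nat.cast_one]
      set x := (star (v j) ⬝ᵥ e).re with hx
      have hxε : |x| ≤ P.ε j := by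
        refine abs_le_of_sq_le_sq ?_ (hε j).le
        refine le_trans ?_ (hve j)
        rw [← sq_abs]
        gcongr
        exact Complex.abs_re_le_norm _
      have hsig : (R j + x) ^ 2 ≤ ‖star (v j) ⬝ᵥ h‖ ^ 2 := by
        rw [hhe, dotProduct_add, hvR, ← sq_abs]
        gcongr
        have := Complex.abs_re_le_norm ((R j : ℂ) + star (v j) ⬝ᵥ e)
        simpa using this
      have hsum : ∑ l ∈ Finset.univ.erase j, quad (B l + ((d * τ : ℝ) : ℂ) • V l) h ≤
          ∑ l ∈ Finset.univ.erase j, quad (S l) h + d * τ * (((M : ℝ) - 1) * P.ε j ^ 2) := by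
        simp only [hquad, Finset.sum_add_distrib, ← Finset.mul_sum]
        gcongr with l _
        exact hBle l h
      have hγj := (hγ j).le
      have key : quad (S j) h - quad (B j) h + P.γ j * (d * τ * (((M : ℝ) - 1) * P.ε j ^ 2)) ≤
          d * τ * (R j + x) ^ 2 := by
        by_cases hj : j = m
        · subst hj
          have h1 : quad (S j) h - quad (B j) h = quad D h := by
            rw [hSm, quad_add]; simp [hB]
          have h2 : quad D h ≤ d * (P.ε j ^ 2 + 2 * k * x + k ^ 2) := by
            have h3 : h = (P.H.col j - (k : ℂ) • v j) + (e + (k : ℂ) • v j) := by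
              rw [hhe]; abel
            rw [h3, quad_eq_of_mulVec_eq_zero hD.isHermitian hDq]
            refine (quad_le_trace_mul hD _).trans ?_
            rw [sum_normSq_add_smul, hv1, mul_one]
            gcongr
          rw [h1]
          have h4 := mul_le_mul_of_nonneg_left (hpert x hxε) hdpos.le
          linarith
        -- Users other than m lose no signal and need only offset the new interference.
        · have h1 : quad (S j) h - quad (B j) h = 0 := by simp [hB, hj]
          obtain ⟨h2, h3⟩ := mul_sq_le_sub_sq hμ (hγ j) (hε j) (hRpos j) (hR j)
          have h4 : (R j - P.ε j) ^ 2 ≤ (R j + x) ^ 2 := by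
            have := (abs_le.1 hxε).1
            have h5 : 0 ≤ R j - P.ε j := by linarith
            exact pow_le_pow_left₀ h5 (by linarith) 2
          have h5 := mul_le_mul_of_nonneg_left (h3.trans h4) hdτ.le
          rw [h1]
          linarith
      change P.γ j * (∑ l ∈ Finset.univ.erase j, quad (B l + ((d * τ : ℝ) : ℂ) • V l) h +
        P.σ j ^ 2) ≤ quad (B j + ((d * τ : ℝ) : ℂ) • V j) h
      rw [hquad j h]
      have h6 := mul_le_mul_of_nonneg_left hsum hγj
      have h7 := mul_le_mul_of_nonneg_left hsig hdτ.le
      linarith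
    · have hrow := hS.2 j n hn
      ext i
      -- For user m, the zero diagonal entry is the sum of ‖a n‖² and a nonnegative entry of D, so a
      -- also vanishes on T.
      have hBrow : B j n i = 0 := by
        by_cases hj : j = m
        · subst hj
          have h1 : (S j n n).re = 0 := by
            have := congrFun hrow n
            simp only [Matrix.row_apply, Pi.zero_apply] at this
            simp [this]
          have h2 : (S j n n).re = ‖a n‖ ^ 2 + (D n n).re := by
            rw [hSm, hA, Matrix.add_apply, Matrix.vecMulVec_apply, Pi.star_apply, RCLike.star_def,
              Complex.mul_conj', Complex.add_re]
            norm_cast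
          have h3 := diag_re_nonneg hD n
          have h4 : a n = 0 := by
            rw [← norm_eq_zero]
            exact pow_eq_zero_iff two_ne_zero |>.1 (le_antisymm (by linarith) (by positivity))
          simp [hB, hA, Matrix.vecMulVec_apply, h4]
        · have := congrFun hrow i
          simpa [hB, hj] using this
      simp [hBrow, hV, Matrix.vecMulVec_apply, hvT j n hn]
  have hle := hopt _ hfeas
  have hcost : liftedPower (fun j => B j + ((d * τ : ℝ) : ℂ) • V j) =
      liftedPower S - d + M * (d * τ) := by
    have h1 : ∀ j, (V j).trace.re = 1 := fun j => by rw [hV]; simp only [trace_vecMulVec_re, hv1]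
    have h2 : liftedPower S = liftedPower B + d := by
      unfold liftedPower
      rw [← Finset.add_sum_erase _ _ (Finset.mem_univ m),
        ← Finset.add_sum_erase (a := m) _ (fun j => (B j).trace.re) (Finset.mem_univ m), hSm]
      have h3 : ∑ j ∈ Finset.univ.erase m, (B j).trace.re =
          ∑ j ∈ Finset.univ.erase m, (S j).trace.re :=
        Finset.sum_congr rfl fun j hj => by simp [hB, Finset.ne_of_mem_erase hj]
      rw [h3, Matrix.trace_add, Complex.add_re]
      simp only [hB, Function.update_self]
      ring
    rw [h2]
    unfold liftedPower
    simp only [Matrix.trace_add, Matrix.trace_smul, Complex.add_re, smul_eq_mul,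
      Complex.re_ofReal_mul, h1, Finset.sum_add_distrib, Finset.sum_const, Finset.card_univ,
      Fintype.card_fin, nsmul_eq_mul, mul_one]
    ring
  rw [hcost] at hle
  -- Optimality would give d ≤ M d τ, against d > 0 and M τ < 1.
  nlinarith

/-! ### Imperfect CSI -/

theorem quad_vecMulVec_col (W : Beam N M) (j : Fin M) (h : Fin N → ℂ) :
    quad (Matrix.vecMulVec (W.col j) (star (W.col j))) h = ‖gain W j h‖ ^ 2 :=
  quad_vecMulVec _ _

theorem liftedPower_rankOne (W : Beam N M) :
    liftedPower (fun m => Matrix.vecMulVec (W.col m) (star (W.col m))) = power W := by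
  simp only [liftedPower, trace_vecMulVec_re, power, Matrix.col_apply]
  exact Finset.sum_comm

/-- Tightness is needed only where exactly N - L antennas are shut down. At inner nodes the
relaxation supplies lower bounds, for which monotonicity suffices; conversely, each feasible W lifts
to a rank-one point of equal power. -/
theorem exactOnLeaves_sdr {P : Instance N M} (hLN : L ≤ N) (hσ : ∀ m, 0 < P.σ m)
    (hγ : ∀ m, 0 < P.γ m) (hε : ∀ m, 0 < P.ε m) (hcond : sdrCondition P L)
    {solve : Finset (Fin N) → Option (Lifted N M)} (h : IsSolver (sdr P) solve) :
    ExactOnLeaves solve liftedPower extract L (rbfas P L) := by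
  refine ⟨fun T S hT hs => ?_, fun B T hBT => ?_, fun W hW => ?_⟩
  · obtain ⟨hS, hopt⟩ := (h T).1 S hs
    choose a ha using exists_eq_vecMulVec_of_optimal hLN hσ hγ hε hcond hT hS hopt
    have hex : ∃ W : Beam N M, ∀ m, S m = Matrix.vecMulVec (W.col m) (star (W.col m)) :=
      ⟨Matrix.of fun n m => a m n, ha⟩
    obtain ⟨W, hW, hext⟩ : ∃ W : Beam N M,
        (∀ m, S m = Matrix.vecMulVec (W.col m) (star (W.col m))) ∧ extract S = some W :=
      ⟨hex.choose, hex.choose_spec, dif_pos hex⟩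
    refine ⟨W, hext, ⟨fun m x hx => ?_, rowZero_le hLN hT fun n hn => ?_⟩, ?_⟩
    · have := hS.1.2 m x hx
      simp only [hW, quad_vecMulVec_col] at this
      exact this
    · ext m
      have := congrFun (hS.2 m n hn) n
      rw [hW m, Matrix.row_apply, Matrix.vecMulVec_apply, Pi.star_apply] at this
      simpa using this
    · rw [← liftedPower_rankOne, ← funext hW]
  · exact solvedValue_mono h (fun _ => rfl) fun S hS => ⟨hS.1, fun m n hn => hS.2 m n (hBT hn)⟩
  · obtain ⟨T, hT, hz⟩ := exists_shutDown hLN hW.2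
    refine ⟨T, hT, ?_⟩
    rw [← liftedPower_rankOne]
    refine solvedValue_le h rfl ⟨⟨fun m => Matrix.posSemidef_vecMulVec_self_star _,
      fun m x hx => ?_⟩, fun m n hn => ?_⟩
    · simp only [quad_vecMulVec_col]
      exact hW.1 m x hx
    · ext i
      have := congrFun (hz n hn) m
      simp only [Matrix.row_apply, Pi.zero_apply] at this
      simp [Matrix.vecMulVec_apply, this]

end BFAS

/-! ### Global optimality and program counts of the two methods -/

theorem theorem1 (N M L : ℕ) (hM : 0 < M) (hL : 1 ≤ L) (hLN : L ≤ N)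
    (P : BFAS.Instance N M) (hσ : ∀ m, 0 < P.σ m) (hγ : ∀ m, 0 < P.γ m) :
    -- (a) perfect CSI
    ((∃ solve, BFAS.IsSolver (BFAS.socp P) solve) ∧
      ∀ solve, BFAS.IsSolver (BFAS.socp P) solve → ∀ tol : ℝ≥0,
        (BFAS.socpBB solve).SolvesOptimally L tol (BFAS.bfas P L)) ∧
    -- (b) imperfect CSI
    ((∀ m, 0 < P.ε m) → BFAS.sdrCondition P L →
      (∃ solve, BFAS.IsSolver (BFAS.sdr P) solve) ∧
      ∀ solve, BFAS.IsSolver (BFAS.sdr P) solve → ∀ tol : ℝ≥0,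
        (BFAS.sdrBB solve).SolvesOptimally L tol (BFAS.rbfas P L)) ∧
    -- (c) number of SOCPs/SDRs solved by the proposed method
    (∀ tol : ℝ≥0,
      (∀ solve, BFAS.IsSolver (BFAS.socp P) solve →
        (BFAS.socpBB solve).SolvesAtMost L tol
          (N.choose L + ∑ i ∈ Finset.Icc 2 (N - L + 1), (N - i).choose (L - 1))) ∧
      (∀ solve, BFAS.IsSolver (BFAS.sdr P) solve →
        (BFAS.sdrBB solve).SolvesAtMost L tol
          (N.choose L + ∑ i ∈ Finset.Icc 2 (N - L + 1), (N - i).choose (L - 1)))) ∧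
    -- (c) number of SOCPs/SDRs solved by the alternative method
    (∀ C : ℝ, 0 < C →
      (∃ solve, BFAS.IsSolver (BFAS.bigMSocp P L C) solve) ∧
      (∃ solve, BFAS.IsSolver (BFAS.bigMSdr P L C) solve) ∧
      ∀ tol : ℝ≥0,
        (∀ solve, BFAS.IsSolver (BFAS.bigMSocp P L C) solve →
          (BFAS.bigMSocpBB solve).SolvesAtMost L tol (2 * N.choose L - 1)) ∧
        (∀ solve, BFAS.IsSolver (BFAS.bigMSdr P L C) solve →
          (BFAS.bigMSdrBB solve).SolvesAtMost L tol (2 * N.choose L - 1))) := by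
  refine ⟨⟨BFAS.exists_isSolver_socp P, fun solve h tol =>
      (BFAS.exactOnLeaves_socp hLN hσ hγ h).solvesOptimally hLN tol⟩,
    fun hε hcond => ⟨BFAS.exists_isSolver_sdr hσ, fun solve h tol =>
      (BFAS.exactOnLeaves_sdr hLN hσ hγ hε hcond h).solvesOptimally hLN tol⟩,
    fun tol => ⟨fun solve _ => BFAS.solvesAtMost_powerBB _ _ _ _ hL hLN tol,
      fun solve _ => BFAS.solvesAtMost_powerBB _ _ _ _ hL hLN tol⟩,
    fun C _ => ⟨BFAS.exists_isSolver_bigMSocp P C, BFAS.exists_isSolver_bigMSdr hσ C,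
      fun tol => ⟨fun solve _ => BFAS.solvesAtMost_booleanBB _ _ _ hL hLN tol,
        fun solve _ => BFAS.solvesAtMost_booleanBB _ _ _ hL hLN tol⟩⟩⟩
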